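/- Let $X$ be a nonempty set and $\theta\colon X\to X$ a mapping. Mappings are written on the right and composed from left to right; $\pi_a$ denotes the kernel of a mapping $a$. **Normal categories, duals, cross-connections.** A category with subobjects is a category $\mathcal C$ whose objects are partially ordered, with chosen monomorphisms (inclusions) $j(c,d)\colon c\to d$ for $c\le d$, such that $j(c,c)=1_c$, $j(c,d)j(d,e)=j(c,e)$, and if $h\,j(d,e)=j(c,e)$ then $c\le d$ and $h=j(c,d)$. A normal cone $\gamma$ with vertex $d$ is a family $\gamma(c)\colon c\to d$ $(c\in v\mathcal C)$ with $j(c,c')\gamma(c')=\gamma(c)$ for $c\le c'$, at least one $\gamma(c)$ being an isomorphism. $\mathcal C$ is normal if inclusions split, every morphism $f$ is a product $f=quj$ of a retraction (a right inverse of an inclusion), an isomorphism and an inclusion, and every object $c$ is the vertex of a normal cone $\gamma$ with $\gamma(c)=1_c$; $f^\circ=qu$ is then uniquely determined. For a normal cone $\gamma$ with vertex $d$ and $f\colon d\to c$, $\gamma*f^\circ$ is the normal cone $c'\mapsto\gamma(c')f^\circ$, and $\gamma\cdot\sigma=\gamma*(\sigma(d))^\circ$. The functor $H(\gamma;-)\colon\mathcal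 C\to\mathbf{Set}$ is given by $H(\gamma;c)=\{\gamma*f^\circ: f\in\mathcal C(d,c)\}$ and $H(\gamma;g)\colon\gamma*f^\circ\mapsto\gamma*(fg)^\circ$. The normal dual $N^*\mathcal C$ has as objects the functors $H(\varepsilon;-)$, $\varepsilon$ an idempotent normal cone, as morphisms all natural transformations, and as inclusions the inclusions of subfunctors; the M-set of $H(\varepsilon;-)$ is $\{c:\varepsilon(c)\text{ is an isomorphism}\}$. A local isomorphism is a fully faithful inclusion-preserving functor $F$ that restricts, for each object $c$, to an isomorphism of categories $\langle c\rangle\to\langle F(c)\rangle$, where $\langle c\rangle$ is the full subcategory of the objects $c'\le c$; it is proper if $F$ is not an isomorphism of categories. A cross-connection between normal categories $\mathcal C$ and $\mathcal D$ is a local isomorphism $F\colon\mathcal C\to N^*\mathcal D$ such that every object of $\mathcal D$ lies in the M-set of some $F(c)$. **The categories.** $\mathscr P_\theta$ has as objects the nonempty subsets $A\subseteq X$ on which $\theta$ is injective, as morphisms all mappings, and is ordered by inclusion. $\Pi_\theta$ has as objects the sets $\bar\pi$ of all mappings $\pi\to X$, for the partitions $\pi$ of $X$ each of whose classes meets $\operatorname{Im}\theta$,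 as morphisms $\bar\pi_1\to\bar\pi_2$ the mappings $\eta^*\colon\alpha\mapsto\eta\alpha$ for mappings $\eta\colon\pi_2\to\pi_1$, and is ordered by inclusion (mappings on $\pi$ being viewed as mappings on $X$). **Identifications.** A transformation $a$ of $X$ with $\bar\pi_a\in v\Pi_\theta$ gives a cone in $\Pi_\theta$ with vertex $\bar\pi_a$ and components $\alpha\mapsto a\alpha$; a transformation $a$ with $\operatorname{Im}a\in v\mathscr P_\theta$ gives a cone in $\mathscr P_\theta$ with vertex $\operatorname{Im}a$ and components $a_{|A}$. A subset $D$ of $X$ is regarded as the object $H(\varepsilon;-)$ of $N^*\Pi_\theta$ if the idempotent cone $\varepsilon$ is given by a transformation with image $D$; a mapping $g\colon D\to D'$ is then regarded as the natural transformation that sends the cone given by $c$ (for $c\colon X\to D$ constant on the classes of $\sigma$, at the object $\bar\sigma$) to the cone given by $cg$. A partition $\rho$ is regarded as the object $H(\varepsilon;-)$ of $N^*\mathscr P_\theta$ if the idempotent cone $\varepsilon$ is given by a transformation with kernel $\rho$; a mapping $h$ is regarded as the natural transformation $h^*$ from $\rho$ that sends the cone given by $a$ (for $a\colon X\to A$ constant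 on the classes of $\rho$, at the object $A$) to the cone given by $ha$. **Proposition.** $\mathscr P_\theta$ and $\Pi_\theta$ are normal categories, and: 1. There is a functor $\Delta_\theta\colon\mathscr P_\theta\to N^*\Pi_\theta$ with $\Delta_\theta(A)=A\theta$ and $\Delta_\theta(f)=(\theta_{|A})^{-1}f\theta\colon A\theta\to B\theta$ for $f\colon A\to B$. It is a local isomorphism, and every object of $\Pi_\theta$ lies in the M-set of some $\Delta_\theta(A)$; hence $\Delta_\theta$ is a cross-connection between $\mathscr P_\theta$ and $\Pi_\theta$. If $\theta$ is not a permutation, $\Delta_\theta$ is proper. 2. Dually, there is a functor $\Gamma_\theta\colon\Pi_\theta\to N^*\mathscr P_\theta$ with $\Gamma_\theta(\bar\pi)=\pi\theta^{-1}$ (the partition with $x\sim y$ iff $x\theta\mathrel{\pi}y\theta$) and $\Gamma_\theta(\eta^*)=(\theta\,\eta\,(\theta_{|C})^{-1})^*$ for $\eta\colon\pi_2\to\pi_1$ and every cross-section $C\in v\mathscr P_\theta$ of $\pi_1\theta^{-1}$, where a class of $\pi_1$ is identified with its unique element in $C\theta$. It is a cross-connection between $\Pi_\theta$ and $\mathscr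 P_\theta$, and it is proper if $\theta$ is neither a permutation nor constant. -/

import Mathlib

open CategoryTheory

universe v u w z

namespace CrossConnection

/-! ## Normal categories -/

/-- A category with subobjects: the objects are partially ordered, and every relation `c ≤ d` comes
with a distinguished monomorphism, the *inclusion* `j(c,d)`.  Inclusions form a subcategory, and if
`h ≫ g` and `g` are inclusions, then so is `h`. -/
class CategoryWithSubobjects (C : Type u) [Category.{v} C] extends PartialOrder C where
  incl : ∀ {c d : C}, c ≤ d → (c ⟶ d)
  incl_refl : ∀ c : C, incl (le_refl c) = 𝟙 c
  incl_trans : ∀ {c d e : C} (h₁ : c ≤ d) (h₂ : d ≤ e), incl h₁ ≫ incl h₂ = incl (h₁.trans h₂)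
  incl_mono : ∀ {c d : C} (h : c ≤ d), Mono (incl h)
  incl_of_comp : ∀ {c d e : C} (f : c ⟶ d) (h₁ : c ≤ e) (h₂ : d ≤ e),
    f ≫ incl h₂ = incl h₁ → ∃ h : c ≤ d, f = incl h

open CategoryWithSubobjects

/-- A cone over the inclusions of `C`: a vertex `d` and morphisms `γ(c) : c ⟶ d`
with `j(c,c') γ(c') = γ(c)` whenever `c ≤ c'`. -/
structure InclCone (C : Type u) [Category.{v} C] [CategoryWithSubobjects C] where
  vertex : C
  app : ∀ c : C, c ⟶ vertex
  incl_app : ∀ {c c' : C} (h : c ≤ c'), incl h ≫ app c' = app c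

/-- A normal cone: some component is an isomorphism. -/
@[ext]
structure NormalCone (C : Type u) [Category.{v} C] [CategoryWithSubobjects C] where
  toCone : InclCone C
  exists_isIso : ∃ c : C, IsIso (toCone.app c)

/-- The vertex of a normal cone. -/
abbrev NormalCone.vertex {C : Type u} [Category.{v} C] [CategoryWithSubobjects C]
    (γ : NormalCone C) : C := γ.toCone.vertex

/-- The component `γ(c)` of a normal cone. -/
abbrev NormalCone.app {C : Type u} [Category.{v} C] [CategoryWithSubobjects C]
    (γ : NormalCone C) (c : C) : c ⟶ γ.vertex := γ.toCone.app c

/-- A normal category: a category with subobjects in which inclusions split, every morphism has a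
normal factorization `f = q u j` (`q` a retraction, `u` an isomorphism, `j` an inclusion), and
every object `c` is the vertex of a normal cone `γ` with `γ(c) = 1`. -/
class NormalCategory (C : Type u) [Category.{v} C] extends CategoryWithSubobjects C where
  incl_split : ∀ {c d : C} (h : c ≤ d), ∃ q : d ⟶ c, incl h ≫ q = 𝟙 c
  exists_factorization : ∀ {c d : C} (f : c ⟶ d),
    ∃ (c' d' : C) (hc : c' ≤ c) (hd : d' ≤ d) (q : c ⟶ c') (u : c' ⟶ d'),
      incl hc ≫ q = 𝟙 c' ∧ IsIso u ∧ f = q ≫ u ≫ incl hd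
  exists_cone : ∀ c : C, ∃ γ : InclCone C, ∃ h : γ.vertex = c, γ.app c ≫ eqToHom h = 𝟙 c

section Normal

variable {C : Type u} [Category.{v} C] [NormalCategory C]

/-- The image `Im f` of a morphism. -/
noncomputable def image {c d : C} (f : c ⟶ d) : C :=
  (NormalCategory.exists_factorization f).choose_spec.choose

/-- `g : c ⟶ d'` is an epimorphic part of `f : c ⟶ d`: the product `q u` of the retraction and
the isomorphism of a normal factorization `f = q u j(d',d)`. -/
def IsEpiPart {c d d' : C} (f : c ⟶ d) (hd : d' ≤ d) (g : c ⟶ d') : Prop :=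
  ∃ (c' : C) (hc : c' ≤ c) (q : c ⟶ c') (u : c' ⟶ d'),
    incl hc ≫ q = 𝟙 c' ∧ IsIso u ∧ g = q ≫ u ∧ f = g ≫ incl hd

theorem exists_isEpiPart {c d : C} (f : c ⟶ d) :
    ∃ (hd : image f ≤ d) (g : c ⟶ image f), IsEpiPart f hd g := by
  obtain ⟨hc, hd, q, u, h1, h2, h3⟩ :=
    (NormalCategory.exists_factorization f).choose_spec.choose_spec
  exact ⟨hd, q ≫ u, _, hc, q, u, h1, h2, rfl, h3.trans (Category.assoc _ _ _).symm⟩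

theorem image_le {c d : C} (f : c ⟶ d) : image f ≤ d := (exists_isEpiPart f).choose

/-- The epimorphic component `f° : c ⟶ Im f`. -/
noncomputable def epiComp {c d : C} (f : c ⟶ d) : c ⟶ image f :=
  (exists_isEpiPart f).choose_spec.choose

theorem isEpiPart_epiComp {c d : C} (f : c ⟶ d) : IsEpiPart f (image_le f) (epiComp f) :=
  (exists_isEpiPart f).choose_spec.choose_spec

theorem epiComp_incl {c d : C} (f : c ⟶ d) : epiComp f ≫ incl (image_le f) = f := by
  obtain ⟨_, _, _, _, _, _, _, h⟩ := isEpiPart_epiComp f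
  exact h.symm

/-- The epimorphic component does not depend on the normal factorization. -/
theorem epiPart_unique {c d d₁ d₂ : C} {f : c ⟶ d} {h₁ : d₁ ≤ d} {h₂ : d₂ ≤ d}
    {g₁ : c ⟶ d₁} {g₂ : c ⟶ d₂} (H₁ : IsEpiPart f h₁ g₁) (H₂ : IsEpiPart f h₂ g₂) :
    ∃ h : d₁ = d₂, g₁ ≫ eqToHom h = g₂ := by
  have key : ∀ {a b : C} {ha : a ≤ d} {hb : b ≤ d} {p : c ⟶ a} {r : c ⟶ b},
      IsEpiPart f ha p → IsEpiPart f hb r → a ≤ b := by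
    rintro a b ha hb p r ⟨c', hc, q, t, hq, ht, rfl, hp⟩ ⟨_, _, _, _, _, _, _, hr⟩
    have : (inv t ≫ incl hc ≫ r) ≫ incl hb = incl ha := by
      simp only [Category.assoc]
      rw [← hr, hp]
      simp only [Category.assoc]
      rw [reassoc_of% hq]
      simp
    exact (incl_of_comp _ _ _ this).choose
  obtain rfl := le_antisymm (key H₁ H₂) (key H₂ H₁)
  refine ⟨rfl, ?_⟩
  obtain ⟨_, _, _, _, _, _, _, e₁⟩ := H₁
  obtain ⟨_, _, _, _, _, _, _, e₂⟩ := H₂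
  have := incl_mono h₁
  simpa using (cancel_mono (incl h₁)).1 (e₁.symm.trans e₂)

namespace NormalCone

/-- The normal cone `γ * f°` with vertex `Im f` and components `γ(c) f°`. -/
noncomputable def star (γ : NormalCone C) {d : C} (f : γ.vertex ⟶ d) : NormalCone C where
  toCone :=
    { vertex := image f
      app := fun c => γ.app c ≫ epiComp f
      incl_app := fun h => by rw [← Category.assoc, γ.toCone.incl_app h] }
  exists_isIso := by
    obtain ⟨c', hc, q, t, hq, ht, hg, -⟩ := isEpiPart_epiComp f
    obtain ⟨k, hk⟩ := γ.exists_isIso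
    obtain ⟨c₁, k₁, hc₁, hk₁, q₁, t₁, hq₁, ht₁, e⟩ :=
      NormalCategory.exists_factorization (incl hc ≫ inv (γ.app k))
    have hm := incl_mono hc
    have hq₁m : Mono q₁ := by
      have : Mono (q₁ ≫ t₁ ≫ incl hk₁) := by rw [← e]; infer_instance
      exact mono_of_mono q₁ (t₁ ≫ incl hk₁)
    have hq₁i : IsIso q₁ := ⟨incl hc₁, by
      rw [← cancel_mono q₁, Category.assoc, hq₁]; simp, hq₁⟩
    refine ⟨k₁, ?_⟩
    have h1 : γ.app k₁ = inv (q₁ ≫ t₁) ≫ incl hc := by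
      rw [eq_comm, IsIso.inv_comp_eq]
      change _ = _ ≫ γ.toCone.app k₁
      rw [← γ.toCone.incl_app hk₁]
      have := congrArg (fun m => m ≫ γ.app k) e
      simpa using this
    have h2 : γ.app k₁ ≫ epiComp f = inv (q₁ ≫ t₁) ≫ t := by
      rw [h1, hg, Category.assoc, reassoc_of% hq]
    change IsIso (γ.app k₁ ≫ epiComp f)
    rw [h2]
    infer_instance

theorem star_injective (γ : NormalCone C) {d : C} {f g : γ.vertex ⟶ d}
    (h : γ.star f = γ.star g) : f = g := by
  have key : ∀ {x y : NormalCone C} (_ : x = y) (hx : x.vertex ≤ d) (hy : y.vertex ≤ d) (c : C),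
      x.app c ≫ incl hx = y.app c ≫ incl hy := by
    rintro x _ rfl hx hy c; rfl
  obtain ⟨k, hk⟩ := γ.exists_isIso
  have := key h (image_le f) (image_le g) k
  change (γ.app k ≫ epiComp f) ≫ incl (image_le f) =
    (γ.app k ≫ epiComp g) ≫ incl (image_le g) at this
  rw [Category.assoc, Category.assoc, epiComp_incl, epiComp_incl] at this
  exact (cancel_epi (γ.app k)).1 this

/-- The product `γ · σ = γ * (σ(vertex of γ))°` of the semigroup `TC` of normal cones. -/
noncomputable instance : Mul (NormalCone C) := ⟨fun γ σ => γ.star (σ.app γ.vertex)⟩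

end NormalCone

end Normal

/-! ## The normal dual -/

/-- A functor from `C` to sets, all of whose values are sets of normal cones. -/
structure ConeFunctor (C : Type u) [Category.{v} C] [CategoryWithSubobjects C] where
  obj : C → Set (NormalCone C)
  map : ∀ {c d : C}, (c ⟶ d) → obj c → obj d
  map_id : ∀ (c : C) (x : obj c), map (𝟙 c) x = x
  map_comp : ∀ {c d e : C} (f : c ⟶ d) (g : d ⟶ e) (x : obj c), map (f ≫ g) x = map g (map f x)

namespace ConeFunctor

variable {C : Type u} [Category.{v} C] [CategoryWithSubobjects C]

/-- `F ≤ G` means that `F` is a subfunctor of `G`. -/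
instance : PartialOrder (ConeFunctor C) where
  le F G := ∃ h : ∀ c, F.obj c ⊆ G.obj c, ∀ {c d : C} (f : c ⟶ d) (x : F.obj c),
    (F.map f x : NormalCone C) = G.map f ⟨x, h c x.2⟩
  le_refl F := ⟨fun _ => subset_rfl, fun _ _ => rfl⟩
  le_trans F G K := by
    rintro ⟨h₁, e₁⟩ ⟨h₂, e₂⟩
    exact ⟨fun c => (h₁ c).trans (h₂ c), fun f x => (e₁ f x).trans (e₂ f _)⟩
  le_antisymm F G := by
    rintro ⟨h₁, e₁⟩ ⟨h₂, -⟩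
    obtain ⟨Fo, Fm, _, _⟩ := F
    obtain ⟨Go, Gm, _, _⟩ := G
    obtain rfl : Fo = Go := funext fun c => (h₁ c).antisymm (h₂ c)
    obtain rfl : @Fm = @Gm := by
      funext c d f x
      exact Subtype.ext (e₁ f x)
    rfl

/-- Natural transformations. -/
@[ext]
structure Hom (F G : ConeFunctor C) where
  app : ∀ c : C, F.obj c → G.obj c
  naturality : ∀ {c d : C} (f : c ⟶ d) (x : F.obj c), app d (F.map f x) = G.map f (app c x)

instance : Category (ConeFunctor C) where
  Hom F G := Hom F G
  id F := ⟨fun _ x => x, fun _ _ => rfl⟩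
  comp s t := ⟨fun c x => t.app c (s.app c x), fun f x => by rw [s.naturality, t.naturality]⟩

end ConeFunctor

section Dual

variable {C : Type u} [Category.{v} C] [NormalCategory C]

/-- The H-functor `H(γ;-)`: `H(γ;c) = {γ * f° : f ∈ C(d,c)}`, `d` the vertex of `γ`,
and `H(γ;g)` sends `γ * f°` to `γ * (f g)°`. -/
noncomputable def HFunctor (γ : NormalCone C) : ConeFunctor C where
  obj c := {x | ∃ f : γ.vertex ⟶ c, γ.star f = x}
  map g x := ⟨γ.star (x.2.choose ≫ g), _, rfl⟩
  map_id c x := Subtype.ext (by rw [Category.comp_id]; exact x.2.choose_spec)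
  map_comp f g x := Subtype.ext (by
    have h := (⟨_, rfl⟩ : ∃ k, γ.star k = γ.star (x.2.choose ≫ f)).choose_spec
    change γ.star _ = γ.star (Exists.choose _ ≫ g)
    rw [γ.star_injective h, Category.assoc])

theorem HFunctor_map (γ : NormalCone C) {c d : C} (f : γ.vertex ⟶ c) (g : c ⟶ d) :
    (HFunctor γ).map g ⟨γ.star f, f, rfl⟩ = ⟨γ.star (f ≫ g), f ≫ g, rfl⟩ := by
  apply Subtype.ext
  have h := (⟨f, rfl⟩ : ∃ k, γ.star k = γ.star f).choose_spec
  change γ.star (Exists.choose _ ≫ g) = _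
  rw [γ.star_injective h]

variable (C) in
/-- The normal dual `N*C`: its objects are the H-functors `H(ε;-)` of the idempotent normal cones
`ε`, and its morphisms are all natural transformations. -/
structure NormalDual where
  functor : ConeFunctor C
  exists_idempotent : ∃ ε : NormalCone C, IsIdempotentElem ε ∧ functor = HFunctor ε

namespace NormalDual

instance : Category (NormalDual C) where
  Hom F G := F.functor ⟶ G.functor
  id F := 𝟙 F.functor
  comp s t := ConeFunctor.instCategory.comp s t

/-- The inclusions of `N*C` are the inclusions of subfunctors. -/
instance : CategoryWithSubobjects (NormalDual C) where
  le F G := F.functor ≤ G.functor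
  le_refl F := le_refl F.functor
  le_trans F G K h₁ h₂ := le_trans (α := ConeFunctor C) h₁ h₂
  le_antisymm F G h₁ h₂ := by
    obtain ⟨F, _⟩ := F
    obtain ⟨G, _⟩ := G
    obtain rfl : F = G := le_antisymm h₁ h₂
    rfl
  incl h := ⟨fun c x => ⟨x, h.choose c x.2⟩, fun f x => Subtype.ext (h.choose_spec f x)⟩
  incl_refl _ := rfl
  incl_trans _ _ := rfl
  incl_mono h := ⟨fun s t e => by
    refine ConeFunctor.Hom.ext (funext fun c => funext fun x => ?_)
    have := congrArg (fun k => ((ConeFunctor.Hom.app k c x).1)) e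
    exact Subtype.ext this⟩
  incl_of_comp {F G K} f h₁ h₂ e := by
    have key : ∀ c x, ((ConeFunctor.Hom.app f c x).1) = x.1 := fun c x =>
      congrArg (fun k => ((ConeFunctor.Hom.app k c x).1)) e
    have hs : ∀ c, F.functor.obj c ⊆ G.functor.obj c := fun c x hx => by
      have := (ConeFunctor.Hom.app f c ⟨x, hx⟩).2
      rwa [key] at this
    have hk : ∀ c x, ConeFunctor.Hom.app f c x = ⟨x.1, hs c x.2⟩ := fun c x =>
      Subtype.ext (key c x)
    refine ⟨⟨hs, fun g x => ?_⟩, ?_⟩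
    · rw [← key, ConeFunctor.Hom.naturality f g x, hk]
    · exact ConeFunctor.Hom.ext (funext fun c => funext fun x => hk c x)

/-- The M-set of `H(ε;-)`: the objects at which the cone `ε` has an invertible component. -/
def MSet (F : NormalDual C) : Set C :=
  {c | ∃ ε : NormalCone C, IsIdempotentElem ε ∧ F.functor = HFunctor ε ∧ IsIso (ε.app c)}

end NormalDual

end Dual

/-! ## Local isomorphisms and cross-connections -/

/-- An isomorphism of categories: bijective on objects and on all sets of morphisms. -/
def IsCategoryIso {C : Type u} [Category.{v} C] {D : Type w} [Category.{z} D] (F : C ⥤ D) :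
    Prop :=
  Function.Bijective F.obj ∧ F.Full ∧ F.Faithful

/-- The ideal `⟨c⟩`: the full subcategory of the objects below `c`. -/
abbrev ideal {C : Type u} [Category.{v} C] [CategoryWithSubobjects C] (c : C) :
    ObjectProperty C := fun c' => c' ≤ c

/-- Inclusion preserving functors. -/
def PreservesInclusions {C : Type u} [Category.{v} C] [CategoryWithSubobjects C] {D : Type w}
    [Category.{z} D] [CategoryWithSubobjects D] (F : C ⥤ D) : Prop :=
  ∀ {c d : C} (h : c ≤ d), ∃ h' : F.obj c ≤ F.obj d, F.map (incl h) = incl h'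

/-- The restriction `⟨c⟩ ⥤ ⟨F(c)⟩` of an inclusion preserving functor. -/
def idealFunctor {C : Type u} [Category.{v} C] [CategoryWithSubobjects C] {D : Type w}
    [Category.{z} D] [CategoryWithSubobjects D] {F : C ⥤ D} (hF : PreservesInclusions F) (c : C) :
    (ideal c).FullSubcategory ⥤ (ideal (F.obj c)).FullSubcategory :=
  (ideal (F.obj c)).lift ((ideal c).ι ⋙ F) fun a => (hF a.property).choose

/-- A local isomorphism: an inclusion preserving, fully faithful functor whose restriction to each
ideal `⟨c⟩` is an isomorphism onto `⟨F(c)⟩`. -/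
def IsLocalIso {C : Type u} [Category.{v} C] [CategoryWithSubobjects C] {D : Type w}
    [Category.{z} D] [CategoryWithSubobjects D] (F : C ⥤ D) : Prop :=
  F.Full ∧ F.Faithful ∧
    ∃ hF : PreservesInclusions F, ∀ c : C, IsCategoryIso (idealFunctor hF c)

/-- A cross-connection `(C, D; F)` between normal categories: a local isomorphism `F : C ⥤ N*D`
such that every object of `D` lies in the M-set of some `F(c)`. -/
def IsCrossConnection {C : Type u} [Category.{v} C] [NormalCategory C] {D : Type w}
    [Category.{z} D] [NormalCategory D] (F : C ⥤ NormalDual D) : Prop :=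
  IsLocalIso F ∧ ∀ d : D, ∃ c : C, d ∈ (F.obj c).MSet

/-! ## The subset category `𝒫_θ` and the partition category `Π_θ` -/

section Concrete

variable {X : Type u}

/-- `π` separates `A`: each `π`-class contains at most one element of `A`. -/
def Separates (π : Setoid X) (A : Set X) : Prop := ∀ x ∈ A, ∀ y ∈ A, π x y → x = y

/-- `A` saturates `π`: each `π`-class contains at least one element of `A`. -/
def Saturates (A : Set X) (π : Setoid X) : Prop := ∀ x, ∃ y ∈ A, π x y

/-- `A` is a cross-section of `π`: each `π`-class contains exactly one element of `A`. -/
def IsCrossSection (A : Set X) (π : Setoid X) : Prop :=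
  Function.Bijective fun x : A => (⟦x.1⟧ : Quotient π)

theorem Separates.mono {π : Setoid X} {A B : Set X} (h : Separates π B) (hAB : A ⊆ B) :
    Separates π A := fun x hx y hy => h x (hAB hx) y (hAB hy)

theorem Saturates.mono {A : Set X} {π ρ : Setoid X} (h : Saturates A π) (hπρ : π ≤ ρ) :
    Saturates A ρ := fun x => let ⟨y, hy, hxy⟩ := h x; ⟨y, hy, hπρ hxy⟩

/-- The objects of `𝒫_θ`: the nonempty subsets of `X` separated by `π_θ = ker θ`. -/
@[ext]
structure PTheta (θ : X → X) where
  carrier : Set X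
  nonempty : carrier.Nonempty
  separates : Separates (Setoid.ker θ) carrier

namespace PTheta

variable {θ : X → X}

/-- The morphisms of `𝒫_θ` are all mappings. -/
instance : Category (PTheta θ) where
  Hom A B := A.carrier → B.carrier
  id _ := fun x => x
  comp f g := fun x => g (f x)

theorem isIso_of_bijective {A B : PTheta θ} (f : A ⟶ B)
    (hf : Function.Bijective (f : A.carrier → B.carrier)) : IsIso f := by
  let e := Equiv.ofBijective (f : A.carrier → B.carrier) hf
  exact ⟨e.symm, funext fun x => e.symm_apply_apply x, funext fun x => e.apply_symm_apply x⟩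

instance : CategoryWithSubobjects (PTheta θ) where
  le A B := A.carrier ⊆ B.carrier
  le_refl _ := subset_rfl
  le_trans _ _ _ h₁ h₂ := Set.Subset.trans h₁ h₂
  le_antisymm A B h₁ h₂ := PTheta.ext (Set.Subset.antisymm h₁ h₂)
  incl h := fun x => ⟨x.1, h x.2⟩
  incl_refl _ := rfl
  incl_trans _ _ := rfl
  incl_mono h := ⟨fun s t e => funext fun x => by
    have := congrArg Subtype.val (congrFun e x)
    exact Subtype.ext this⟩
  incl_of_comp f h₁ h₂ e := by
    have key : ∀ x, (f x).1 = x.1 := fun x => congrArg Subtype.val (congrFun e x)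
    refine ⟨fun x hx => ?_, funext fun x => Subtype.ext (key x)⟩
    have := (f ⟨x, hx⟩).2
    rwa [key] at this

open Classical in
instance : NormalCategory (PTheta θ) where
  incl_split {A B} h := by
    obtain ⟨a, ha⟩ := A.nonempty
    refine ⟨fun x => if hx : x.1 ∈ A.carrier then ⟨x.1, hx⟩ else ⟨a, ha⟩, funext fun x => ?_⟩
    exact dif_pos x.2
  exists_factorization {A B} f := by
    let f' : A.carrier → B.carrier := f
    let s : Set.range f' → A.carrier := fun y => y.2.choose
    have hs : ∀ y, f' (s y) = y.1 := fun y => y.2.choose_spec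
    obtain ⟨a, ha⟩ := A.nonempty
    have hA : (Subtype.val '' Set.range s) ⊆ A.carrier := by rintro _ ⟨x, -, rfl⟩; exact x.2
    have hB : (Subtype.val '' Set.range f') ⊆ B.carrier := by rintro _ ⟨x, -, rfl⟩; exact x.2
    let A' : PTheta θ := ⟨Subtype.val '' Set.range s,
      ⟨_, _, ⟨⟨f' ⟨a, ha⟩, _, rfl⟩, rfl⟩, rfl⟩, A.separates.mono hA⟩
    let B' : PTheta θ := ⟨Subtype.val '' Set.range f', ⟨_, _, ⟨⟨a, ha⟩, rfl⟩, rfl⟩,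
      B.separates.mono hB⟩
    let q : A ⟶ A' := fun x => ⟨(s ⟨f' x, x, rfl⟩).1, _, ⟨_, rfl⟩, rfl⟩
    let t : A' ⟶ B' := fun x => ⟨(f' ⟨x.1, hA x.2⟩).1, _, ⟨_, rfl⟩, rfl⟩
    refine ⟨A', B', hA, hB, q, t, ?_, isIso_of_bijective t ⟨?_, ?_⟩, ?_⟩
    · funext x
      obtain ⟨_, _, ⟨y, rfl⟩, rfl⟩ := x
      apply Subtype.ext
      change (s ⟨f' (s y), _⟩).1 = (s y).1
      congr 2
      exact Subtype.ext (hs y)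
    · rintro ⟨_, _, ⟨y, rfl⟩, rfl⟩ ⟨_, _, ⟨z, rfl⟩, rfl⟩ h
      have h' : f' (s y) = f' (s z) := by
        have := congrArg Subtype.val h
        exact Subtype.ext this
      rw [hs, hs] at h'
      obtain rfl : y = z := Subtype.ext h'
      rfl
    · rintro ⟨_, _, ⟨x, rfl⟩, rfl⟩
      have := congrArg Subtype.val (hs ⟨f' x, x, rfl⟩)
      exact ⟨⟨(s ⟨f' x, x, rfl⟩).1, _, ⟨_, rfl⟩, rfl⟩, Subtype.ext this⟩
    · funext x
      exact Subtype.ext (congrArg Subtype.val (hs ⟨f' x, x, rfl⟩)).symm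
  exists_cone A := by
    obtain ⟨a, ha⟩ := A.nonempty
    refine ⟨⟨A, fun B x => if hx : x.1 ∈ A.carrier then ⟨x.1, hx⟩ else ⟨a, ha⟩, fun _ => rfl⟩,
      rfl, ?_⟩
    simp only [eqToHom_refl, Category.comp_id]
    funext x
    exact dif_pos x.2

/-- The cone in `𝒫_θ` given by a transformation `a` whose image lies in `𝒫_θ`: its vertex is
`Im a`, and its component at `A` is the restriction `a|A`. -/
def principalCone [Nonempty X] (a : X → X) (ha : Separates (Setoid.ker θ) (Set.range a)) :
    InclCone (PTheta θ) where
  vertex := ⟨Set.range a, Set.range_nonempty a, ha⟩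
  app _ := fun x => ⟨a x.1, x.1, rfl⟩
  incl_app _ := rfl

end PTheta

/-- The objects of `Π_θ`: the partitions `π` of `X` (as equivalence relations) saturated by
`Im θ`; such a `π` stands for the set `π̄` of all mappings `π → X`, see `bar`. -/
@[ext]
structure PiTheta (θ : X → X) where
  rel : Setoid X
  saturates : Saturates (Set.range θ) rel

namespace PiTheta

variable {θ : X → X}

/-- The morphisms `η* : π̄₁ ⟶ π̄₂` of `Π_θ` are given by the mappings `η` from `π₂` to `π₁`;
`η*` is `α ↦ η α`, see `dualMap`. -/
instance : Category (PiTheta θ) where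
  Hom π₁ π₂ := Quotient π₂.rel → Quotient π₁.rel
  id _ := fun q => q
  comp f g := fun q => f (g q)

/-- The set `π̄` of all mappings from the partition `π` to `X`, as mappings on `X` that are constant
on the classes of `π`. -/
def bar (π : PiTheta θ) : Set (X → X) := {α | π.rel ≤ Setoid.ker α}

/-- The mapping `η* : π̄₁ → π̄₂, α ↦ η α`. -/
def dualMap {π₁ π₂ : PiTheta θ} (η : π₁ ⟶ π₂) (α : π₁.bar) : π₂.bar :=
  ⟨fun x => Quotient.lift α.1 (fun _ _ h => α.2 h) (η ⟦x⟧), fun x y h => by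
    change Quotient.lift _ _ (η ⟦x⟧) = Quotient.lift _ _ (η ⟦y⟧)
    rw [Quotient.sound h]⟩

/-- The morphism is determined by the mapping `η*`. -/
theorem dualMap_injective {π₁ π₂ : PiTheta θ} {η ζ : π₁ ⟶ π₂} (h : dualMap η = dualMap ζ) :
    η = ζ := by
  classical
  funext q
  induction q using Quotient.inductionOn with | _ x => ?_
  by_contra hne
  obtain ⟨y, hy⟩ := Quotient.exists_rep (η ⟦x⟧)
  obtain ⟨z, hz⟩ := Quotient.exists_rep (ζ ⟦x⟧)
  have hyz : ¬ π₁.rel y z := fun hr => hne (by rw [← hy, ← hz]; exact Quotient.sound hr)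
  have hα : (fun t => if π₁.rel y t then y else z) ∈ π₁.bar := fun s t hst => by
    change ite _ _ _ = ite _ _ _
    have : π₁.rel y s ↔ π₁.rel y t :=
      ⟨fun k => π₁.rel.trans' k hst, fun k => π₁.rel.trans' k (π₁.rel.symm' hst)⟩
    simp [this]
  have := congrFun (congrArg Subtype.val (congrFun h ⟨_, hα⟩)) x
  change Quotient.lift _ _ (η ⟦x⟧) = Quotient.lift _ _ (ζ ⟦x⟧) at this
  rw [← hy, ← hz] at this
  change ite (π₁.rel y y) y z = ite (π₁.rel y z) y z at this
  rw [if_pos (π₁.rel.refl' y), if_neg hyz] at this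
  exact hyz (this ▸ π₁.rel.refl' y)

/-- Inclusion of the sets `π̄` is reverse refinement of partitions. -/
theorem bar_subset_bar_iff {π₁ π₂ : PiTheta θ} : π₁.bar ⊆ π₂.bar ↔ π₂.rel ≤ π₁.rel := by
  classical
  refine ⟨fun h x y hxy => ?_, fun h α hα => le_trans h hα⟩
  by_contra hn
  have hα : (fun t => if π₁.rel x t then x else y) ∈ π₁.bar := fun s t hst => by
    change ite _ _ _ = ite _ _ _
    have : π₁.rel x s ↔ π₁.rel x t :=
      ⟨fun k => π₁.rel.trans' k hst, fun k => π₁.rel.trans' k (π₁.rel.symm' hst)⟩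
    simp [this]
  have := h hα hxy
  change ite (π₁.rel x x) x y = ite (π₁.rel x y) x y at this
  rw [if_pos (π₁.rel.refl' x), if_neg hn] at this
  exact hn (this ▸ π₁.rel.refl' x)

theorem isIso_of_bijective {π₁ π₂ : PiTheta θ} (f : π₁ ⟶ π₂)
    (hf : Function.Bijective (f : Quotient π₂.rel → Quotient π₁.rel)) : IsIso f := by
  let e := Equiv.ofBijective (f : Quotient π₂.rel → Quotient π₁.rel) hf
  exact ⟨e.symm, funext fun x => e.apply_symm_apply x, funext fun x => e.symm_apply_apply x⟩

/-- The objects are ordered by `π̄₁ ⊆ π̄₂`, and the inclusion `π̄₁ ⟶ π̄₂` is given by the mapping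
sending a `π₂`-class to the `π₁`-class that contains it. -/
instance : CategoryWithSubobjects (PiTheta θ) where
  le π₁ π₂ := π₁.bar ⊆ π₂.bar
  le_refl _ := subset_rfl
  le_trans _ _ _ h₁ h₂ := Set.Subset.trans h₁ h₂
  le_antisymm _ _ h₁ h₂ := PiTheta.ext
    (le_antisymm (bar_subset_bar_iff.1 h₂) (bar_subset_bar_iff.1 h₁))
  incl h := Quotient.map id fun _ _ k => bar_subset_bar_iff.1 h k
  incl_refl _ := funext fun q => Quotient.inductionOn q fun _ => rfl
  incl_trans _ _ := funext fun q => Quotient.inductionOn q fun _ => rfl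
  incl_mono h := ⟨fun s t e => funext fun q => by
    induction q using Quotient.inductionOn with | _ x => exact congrFun e ⟦x⟧⟩
  incl_of_comp {π₁ π₂ π₃} f h₁ h₂ e := by
    have key : ∀ x, f ⟦x⟧ = (⟦x⟧ : Quotient π₁.rel) := fun x => congrFun e ⟦x⟧
    refine ⟨bar_subset_bar_iff.2 fun {x y} hxy => ?_, funext fun q => ?_⟩
    · have : (⟦x⟧ : Quotient π₁.rel) = ⟦y⟧ := by
        rw [← key, ← key]; exact congrArg f (Quotient.sound hxy)
      exact Quotient.exact this
    · induction q using Quotient.inductionOn with | _ x => exact key x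

open Classical in
instance [Nonempty X] : NormalCategory (PiTheta θ) where
  incl_split {π₁ π₂} h := by
    refine ⟨fun q : Quotient π₁.rel => (⟦q.out⟧ : Quotient π₂.rel), funext fun q => ?_⟩
    exact Quotient.out_eq q
  exists_factorization {π₁ π₂} f := by
    let f' : Quotient π₂.rel → Quotient π₁.rel := f
    obtain ⟨x₀⟩ := ‹Nonempty X›
    let r : Quotient π₁.rel → Quotient π₁.rel := fun q =>
      if q ∈ Set.range f' then q else f' ⟦x₀⟧
    have hr : ∀ q, r (f' q) = f' q := fun q => if_pos ⟨q, rfl⟩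
    have hr' : ∀ q, ∃ p, f' p = r q := fun q => by
      by_cases hq : q ∈ Set.range f'
      · rw [show r q = q from if_pos hq]; exact hq
      · rw [show r q = _ from if_neg hq]; exact ⟨_, rfl⟩
    have hrr : ∀ q, r (r q) = r q := fun q => by
      obtain ⟨p, hp⟩ := hr' q
      rw [← hp, hr]
    have h₁ : π₁.rel ≤ Setoid.ker fun x => r ⟦x⟧ := fun x y h => by
      change r ⟦x⟧ = r ⟦y⟧
      rw [Quotient.sound h]
    have h₂ : π₂.rel ≤ Setoid.ker fun x => f' ⟦x⟧ := fun x y h => by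
      change f' ⟦x⟧ = f' ⟦y⟧
      rw [Quotient.sound h]
    let σ₁ : PiTheta θ := ⟨Setoid.ker fun x => r ⟦x⟧, π₁.saturates.mono h₁⟩
    let σ₂ : PiTheta θ := ⟨Setoid.ker fun x => f' ⟦x⟧, π₂.saturates.mono h₂⟩
    let q : Quotient σ₁.rel → Quotient π₁.rel := Quotient.lift (fun x => r ⟦x⟧) fun _ _ h => h
    let c : Quotient π₁.rel → Quotient σ₁.rel := Quotient.map id fun _ _ h => h₁ h
    let t : Quotient σ₂.rel → Quotient σ₁.rel :=
      Quotient.lift (fun x => c (f' ⟦x⟧)) fun _ _ h => congrArg c h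
    have hqc : ∀ p, q (c p) = r p := fun p => Quotient.inductionOn p fun _ => rfl
    have hq : Function.Injective q := by
      intro a b
      induction a using Quotient.inductionOn with | _ x => ?_
      induction b using Quotient.inductionOn with | _ y => ?_
      exact fun h => Quotient.sound h
    refine ⟨σ₁, σ₂, bar_subset_bar_iff.2 h₁, bar_subset_bar_iff.2 h₂, q, t, ?_,
      isIso_of_bijective (π₁ := σ₁) (π₂ := σ₂) t ⟨?_, ?_⟩, ?_⟩
    · funext p
      change c (q p) = p
      apply hq
      rw [hqc]
      induction p using Quotient.inductionOn with | _ x => exact hrr _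
    · intro a b
      induction a using Quotient.inductionOn with | _ x => ?_
      induction b using Quotient.inductionOn with | _ y => ?_
      intro h
      have h' : q (c (f' ⟦x⟧)) = q (c (f' ⟦y⟧)) := congrArg q h
      rw [hqc, hqc, hr, hr] at h'
      exact Quotient.sound h'
    · intro p
      induction p using Quotient.inductionOn with | _ x => ?_
      obtain ⟨y, hy⟩ := hr' ⟦x⟧
      induction y using Quotient.inductionOn with | _ y => ?_
      refine ⟨⟦y⟧, hq ?_⟩
      change q (c (f' ⟦y⟧)) = r ⟦x⟧
      rw [hqc, hr, hy]
    · funext p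
      induction p using Quotient.inductionOn with | _ x => ?_
      change f' ⟦x⟧ = q (c (f' ⟦x⟧))
      rw [hqc, hr]
  exists_cone π := by
    refine ⟨⟨π, fun σ => fun q : Quotient π.rel => (⟦q.out⟧ : Quotient σ.rel), fun _ => rfl⟩,
      rfl, ?_⟩
    simp only [eqToHom_refl, Category.comp_id]
    exact funext fun q => Quotient.out_eq q

/-- The cone in `Π_θ` given by a transformation `a` with `π_a = ker a` in `Π_θ`: its vertex is
`π̄_a`, and its component at `σ̄` is `α ↦ a α`, that is, the mapping from the partition `π_a` to
`σ` induced by `a`. -/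
def principalCone (a : X → X) (ha : Saturates (Set.range θ) (Setoid.ker a)) :
    InclCone (PiTheta θ) where
  vertex := ⟨Setoid.ker a, ha⟩
  app σ := fun q : Quotient (Setoid.ker a) =>
    Quotient.lift (fun x => (⟦a x⟧ : Quotient σ.rel)) (fun _ _ h => congrArg _ h) q
  incl_app _ := funext fun q => Quotient.inductionOn q fun _ => rfl

end PiTheta

/-! ## Subsets and partitions as objects of the normal duals -/

section Representation

variable [Nonempty X] {θ : X → X}

/-- The object `F` of `N*Π_θ` is the subset `D` of `X`: it is `H(ε;-)` for an idempotent cone `ε`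
given by a transformation with image `D`. -/
def IsSubsetObj (F : NormalDual (PiTheta θ)) (D : Set X) : Prop :=
  ∃ ε : NormalCone (PiTheta θ), IsIdempotentElem ε ∧ F.functor = HFunctor ε ∧
    ∃ (e : X → X) (he : Saturates (Set.range θ) (Setoid.ker e)),
      Set.range e = D ∧ ε.toCone = PiTheta.principalCone e he

/-- The morphism `τ` of `N*Π_θ` between the subsets `D` and `D'` is the mapping `g : D → D'`:
its component at `σ̄` sends the cone given by `c`, for each `c : X → D` constant on the `σ`-classes,
to the cone given by `c g`. -/
def IsSubsetHom {F G : NormalDual (PiTheta θ)} (τ : F ⟶ G) {D D' : Set X} (g : D → D') : Prop :=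
  ∀ (σ : PiTheta θ) (c : X → D) (hc : σ.rel ≤ Setoid.ker c), ∃ x : F.functor.obj σ,
    x.1.toCone = PiTheta.principalCone (fun y => (c y : X))
      (σ.saturates.mono fun _ _ h => congrArg Subtype.val (hc h)) ∧
    (ConeFunctor.Hom.app τ σ x).1.toCone = PiTheta.principalCone (fun y => (g (c y) : X))
      (σ.saturates.mono fun _ _ h => congrArg (fun d => (g d : X)) (hc h))

/-- The object `F` of `N*𝒫_θ` is the partition `ρ` of `X`: it is `H(ε;-)` for an idempotent cone
`ε` given by a transformation with kernel `ρ`. -/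
def IsPartitionObj (F : NormalDual (PTheta θ)) (ρ : Setoid X) : Prop :=
  ∃ ε : NormalCone (PTheta θ), IsIdempotentElem ε ∧ F.functor = HFunctor ε ∧
    ∃ (e : X → X) (he : Separates (Setoid.ker θ) (Set.range e)),
      Setoid.ker e = ρ ∧ ε.toCone = PTheta.principalCone e he

/-- The morphism `τ` of `N*𝒫_θ` from the partition `ρ` is the morphism `h*` given by `h : X → X`:
its component at `A` sends the cone given by `a`, for each `a : X → A` constant on the `ρ`-classes,
to the cone given by `h a`. -/
def IsPartitionHom {F G : NormalDual (PTheta θ)} (τ : F ⟶ G) (ρ : Setoid X) (h : X → X) : Prop :=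
  ∀ (A : PTheta θ) (a : X → A.carrier), ρ ≤ Setoid.ker a → ∃ x : F.functor.obj A,
    x.1.toCone = PTheta.principalCone (fun y => (a y : X))
      (A.separates.mono (Set.range_subset_iff.2 fun y => (a y).2)) ∧
    (ConeFunctor.Hom.app τ A x).1.toCone = PTheta.principalCone (fun y => (a (h y) : X))
      (A.separates.mono (Set.range_subset_iff.2 fun y => (a (h y)).2))

end Representation

/-! ## The maps that define `Δ_θ` and `Γ_θ` -/

section Maps

variable {θ : X → X}

/-- The bijection `θ|A : A → Aθ` for `A` in `𝒫_θ`. -/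
noncomputable def restrictEquiv (A : PTheta θ) : A.carrier ≃ θ '' A.carrier :=
  Equiv.Set.imageOfInjOn θ A.carrier fun x hx y hy h => A.separates x hx y hy h

/-- The mapping `(θ|A)⁻¹ f θ : Aθ → Bθ` for `f : A → B` in `𝒫_θ`. -/
noncomputable def deltaMap {A B : PTheta θ} (f : A ⟶ B) : θ '' A.carrier → θ '' B.carrier :=
  fun y => restrictEquiv B (f ((restrictEquiv A).symm y))

/-- If `C` is a cross-section of `πθ⁻¹`, then `Cθ` is a cross-section of `π`. -/
theorem isCrossSection_image (π : PiTheta θ) {C : Set X}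
    (hC : IsCrossSection C (π.rel.comap θ)) : IsCrossSection (θ '' C) π.rel := by
  constructor
  · rintro ⟨_, x, hx, rfl⟩ ⟨_, y, hy, rfl⟩ h
    have h' : π.rel (θ x) (θ y) := Quotient.exact h
    have := @hC.1 ⟨x, hx⟩ ⟨y, hy⟩ (Quotient.sound h')
    exact Subtype.ext (congrArg (fun z : C => θ z.1) this)
  · intro q
    induction q using Quotient.inductionOn with | _ x => ?_
    obtain ⟨_, ⟨y, rfl⟩, hy⟩ := π.saturates x
    obtain ⟨z, hz⟩ := hC.2 ⟦y⟧
    have hz' : π.rel (θ z.1) (θ y) := Quotient.exact (s := π.rel.comap θ) hz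
    exact ⟨⟨θ z.1, z.1, z.2, rfl⟩, Quotient.sound (π.rel.trans' hz' (π.rel.symm' hy))⟩

/-- The mapping `θ η (θ|C)⁻¹ : X → C` for `η : π₂ → π₁` and a cross-section `C` in `𝒫_θ` of
`π₁θ⁻¹`; here a class of `π₁` is identified with its unique element in `Cθ`. -/
noncomputable def gammaMap {π₁ π₂ : PiTheta θ} (η : π₁ ⟶ π₂) (C : PTheta θ)
    (hC : IsCrossSection C.carrier (π₁.rel.comap θ)) : X → X :=
  fun x => ((restrictEquiv C).symm
    ((Equiv.ofBijective _ (isCrossSection_image π₁ hC)).symm (η ⟦θ x⟧))).1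

end Maps

end Concrete

end CrossConnection

/-! Sending `f` to `γ * f°` identifies `H(γ;-)` with the functor represented by the vertex of `γ`.
By Yoneda (`HFunctorHom_bijective`), natural transformations between H-functors are morphisms
between vertices in the opposite direction. A family of idempotent cones whose vertices depend
contravariantly on an index category therefore defines a functor into the normal dual, and
`ConeSystem.isCrossConnection_functor` reduces the cross-connection property to conditions on cones
and vertices. Both halves of the theorem are instances.

For `Δ_θ` the cone of `A` comes from a retraction of `X` onto `Aθ`. The classes of its kernel
correspond to the points of `Aθ`, hence of `A` since `θ` is injective on `A`; as morphisms of `Π_θ`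
reverse mappings of classes, morphisms of vertices are exactly mappings between the sets `A`. For
`Γ_θ` the cone of `π` comes from a retraction with kernel `πθ⁻¹`. Its vertex is a set of
representatives that `θ` carries to a cross-section of `π`, because `Im θ` meets every class. In
both cases `γ * f°` is the cone of an explicit transformation, so the conditions become statements
about mappings.

Properness is a failure on objects. `Δ_θ` identifies singletons with the same image under `θ`, and
misses a point outside `Im θ` if `θ` is injective. `Γ_θ` misses a partition that does not contain
`ker θ`, and identifies partitions that differ only outside `Im θ`. -/

namespace CrossConnection

open CategoryWithSubobjects

/-! ### Calculus of the cones `γ * f°` and Yoneda for H-functors -/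

section Star

variable {C : Type u} [Category.{v} C] [NormalCategory C]

/-- A split epimorphism followed by an inclusion is a normal factorization. -/
theorem isEpiPart_of_isSplitEpi {c d d' : C} {f : c ⟶ d} {hd : d' ≤ d} {g : c ⟶ d'}
    [IsSplitEpi g] (h : f = g ≫ incl hd) : IsEpiPart f hd g := by
  obtain ⟨c', e, hc, he, q, t, hq, ht, hg⟩ := NormalCategory.exists_factorization g
  -- The section of `g` factors `1` on `d'` through `j(e,d')`, which forces `d' ≤ e`; the image of a
  -- split epimorphism is thus its whole codomain.
  have hs : (section_ g ≫ q ≫ t) ≫ incl he = incl (le_refl d') := by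
    rw [Category.assoc, Category.assoc, ← hg, IsSplitEpi.id, incl_refl]
  obtain rfl := le_antisymm (incl_of_comp _ _ _ hs).choose he
  rw [incl_refl, Category.comp_id] at hg
  exact ⟨c', hc, q, t, hq, ht, hg, h⟩

instance isSplitEpi_epiComp {c d : C} (f : c ⟶ d) : IsSplitEpi (epiComp f) := by
  obtain ⟨c', hc, q, t, hq, ht, hg, -⟩ := isEpiPart_epiComp f
  exact ⟨⟨⟨inv t ≫ incl hc, by rw [hg, Category.assoc, reassoc_of% hq, IsIso.inv_hom_id]⟩⟩⟩

namespace NormalCone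

/-- The cone `γ * f°` can be computed from any factorization of `f` into a split epimorphism and
an inclusion. -/
theorem star_toCone (γ : NormalCone C) {d d' : C} {f : γ.vertex ⟶ d} (hd : d' ≤ d)
    (g : γ.vertex ⟶ d') [IsSplitEpi g] (h : f = g ≫ incl hd) :
    (γ.star f).toCone =
      { vertex := d'
        app := fun c => γ.app c ≫ g
        incl_app := fun h => by rw [← Category.assoc, γ.toCone.incl_app h] } := by
  obtain ⟨h₁, h₂⟩ := epiPart_unique (isEpiPart_epiComp f) (isEpiPart_of_isSplitEpi h)
  subst h₁ h₂
  simp only [star, eqToHom_refl, Category.comp_id]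

theorem star_id (γ : NormalCone C) : γ.star (𝟙 γ.vertex) = γ := by
  apply NormalCone.ext
  rw [γ.star_toCone le_rfl (𝟙 _) (by rw [incl_refl, Category.comp_id])]
  simp only [Category.comp_id]

/-- Split epimorphisms compose, so `f° g°` followed by the inclusion of `Im g` is an admissible
factorization of `f° g`. -/
theorem star_star (γ : NormalCone C) {d e : C} (f : γ.vertex ⟶ d) (g : image f ⟶ e) :
    (γ.star f).star g = γ.star (epiComp f ≫ g) := by
  have h : epiComp f ≫ g = (epiComp f ≫ epiComp g) ≫ incl (image_le g) := by
    rw [Category.assoc, epiComp_incl]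
  have : IsSplitEpi (epiComp f ≫ epiComp g) :=
    ⟨⟨⟨section_ (epiComp g) ≫ section_ (epiComp f), by simp⟩⟩⟩
  apply NormalCone.ext
  rw [γ.star_toCone _ _ h]
  change InclCone.mk _ _ _ = InclCone.mk _ _ _
  congr 1
  funext c
  exact Category.assoc _ _ _

theorem isIdempotentElem_of_app_vertex {γ : NormalCone C} (h : γ.app γ.vertex = 𝟙 γ.vertex) :
    IsIdempotentElem γ := by
  change γ.star (γ.app γ.vertex) = γ
  rw [h, star_id]

theorem star_split (γ : NormalCone C) {c : C} (g : γ.vertex ⟶ c) [IsSplitMono g] :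
    (γ.star g).star (d := γ.vertex) ((incl (image_le g) ≫ retraction g :)) = γ := by
  have := γ.star_star g (incl (image_le g) ≫ retraction g)
  rwa [← Category.assoc, epiComp_incl, IsSplitMono.id, star_id] at this

end NormalCone

/-- The element `γ * f°` of `H(γ;c)`. -/
noncomputable def starElem (γ : NormalCone C) {c : C} (f : γ.vertex ⟶ c) : (HFunctor γ).obj c :=
  ⟨γ.star f, f, rfl⟩

theorem exists_starElem {γ : NormalCone C} {c : C} (x : (HFunctor γ).obj c) :
    ∃ f, x = starElem γ f := by
  obtain ⟨_, ⟨f, rfl⟩⟩ := x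
  exact ⟨f, rfl⟩

theorem map_starElem (γ : NormalCone C) {c d : C} (f : γ.vertex ⟶ c) (g : c ⟶ d) :
    (HFunctor γ).map g (starElem γ f) = starElem γ (f ≫ g) := HFunctor_map γ f g

/-- If `γ = δ * f°`, then `star_star` rewrites every `γ * g°` as `δ * (f° g)°`, compatibly with
composition on the right. -/
theorem HFunctor_le_of_mem {γ δ : NormalCone C} {c : C} (h : γ ∈ (HFunctor δ).obj c) :
    HFunctor γ ≤ HFunctor δ := by
  obtain ⟨f, rfl⟩ := h
  refine ⟨?_, ?_⟩
  · rintro c _ ⟨g, rfl⟩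
    exact ⟨_, (δ.star_star f g).symm⟩
  · intro c d k x
    obtain ⟨g, rfl⟩ := exists_starElem x
    -- The membership proof is left arbitrary so that the rewrite applies to the one produced by the
    -- inclusion of the value sets.
    have e : ∀ hx, (⟨(starElem (δ.star f) g).1, hx⟩ : (HFunctor δ).obj c) =
        starElem δ (epiComp f ≫ g) := fun hx => Subtype.ext (δ.star_star f g)
    rw [e, map_starElem, map_starElem]
    exact (δ.star_star f (g ≫ k)).trans (congrArg δ.star (Category.assoc _ _ _).symm)

theorem mem_HFunctor_vertex (γ : NormalCone C) : γ ∈ (HFunctor γ).obj γ.vertex :=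
  ⟨𝟙 _, γ.star_id⟩

/-- Each cone lies in the H-functor of the other: a retraction of `g` recovers `γ` from `γ * g°`. -/
theorem HFunctor_star_of_isSplitMono (γ : NormalCone C) {c : C} (g : γ.vertex ⟶ c)
    [IsSplitMono g] : HFunctor (γ.star g) = HFunctor γ :=
  le_antisymm (HFunctor_le_of_mem ⟨g, rfl⟩) (HFunctor_le_of_mem ⟨_, γ.star_split g⟩)

theorem starElem_choose {γ : NormalCone C} {c : C} (f : γ.vertex ⟶ c) :
    (starElem γ f).2.choose = f := γ.star_injective (starElem γ f).2.choose_spec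

/-- The natural transformation `γ * f° ↦ δ * (h f)°` between H-functors. -/
noncomputable def HFunctorHom {γ δ : NormalCone C} (h : δ.vertex ⟶ γ.vertex) :
    ConeFunctor.Hom (HFunctor γ) (HFunctor δ) where
  app c x := starElem δ (h ≫ x.2.choose)
  naturality k x := by
    obtain ⟨f, rfl⟩ := exists_starElem x
    rw [map_starElem, map_starElem, starElem_choose, starElem_choose, Category.assoc]

theorem HFunctorHom_app {γ δ : NormalCone C} (h : δ.vertex ⟶ γ.vertex) {c : C}
    (f : γ.vertex ⟶ c) : (HFunctorHom h).app c (starElem γ f) = starElem δ (h ≫ f) := by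
  change starElem δ (h ≫ (starElem γ f).2.choose) = _
  rw [starElem_choose]

theorem HFunctor_hom_ext {γ δ : NormalCone C} {s t : ConeFunctor.Hom (HFunctor γ) (HFunctor δ)}
    (h : ∀ (c : C) (f : γ.vertex ⟶ c), s.app c (starElem γ f) = t.app c (starElem γ f)) :
    s = t := by
  refine ConeFunctor.Hom.ext (funext fun c => funext fun x => ?_)
  obtain ⟨f, rfl⟩ := exists_starElem x
  exact h c f

/-- The Yoneda lemma for H-functors. -/
theorem HFunctorHom_bijective (γ δ : NormalCone C) :
    Function.Bijective (HFunctorHom : (δ.vertex ⟶ γ.vertex) → _) := by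
  constructor
  · intro h k e
    have := congrArg (fun s => (ConeFunctor.Hom.app s _ (starElem γ (𝟙 _))).1) e
    simp only [HFunctorHom_app, Category.comp_id] at this
    exact δ.star_injective this
  · intro s
    -- As in Yoneda, `s` is determined by its value at the generator `γ = γ * 1°`.
    obtain ⟨h, hh⟩ := exists_starElem (s.app γ.vertex (starElem γ (𝟙 _)))
    refine ⟨h, HFunctor_hom_ext fun c f => ?_⟩
    have h₁ := s.naturality f (starElem γ (𝟙 _))
    rw [map_starElem, hh, map_starElem, Category.id_comp] at h₁
    rw [HFunctorHom_app, h₁]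

end Star

/-! ### A criterion for local isomorphisms -/

section LocalIso

variable {C : Type u} [Category.{v} C] [CategoryWithSubobjects C] {D : Type w} [Category.{z} D]
  [CategoryWithSubobjects D]

/-- A fully faithful inclusion preserving functor reflects the order of each ideal. -/
theorem le_of_obj_le {F : C ⥤ D} [F.Full] [F.Faithful] (hF : PreservesInclusions F) {a b c : C}
    (ha : a ≤ c) (hb : b ≤ c) (h : F.obj a ≤ F.obj b) : a ≤ b := by
  obtain ⟨g, hg⟩ := F.map_surjective (incl h)
  obtain ⟨ha', ea⟩ := hF ha
  obtain ⟨hb', eb⟩ := hF hb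
  -- The preimage `g` of `j(F(a),F(b))` satisfies `g j(b,c) = j(a,c)`. The common bound `c` is
  -- essential: `F` need not be injective on objects outside an ideal.
  refine (incl_of_comp g ha hb (F.map_injective ?_)).choose
  rw [F.map_comp, hg, ea, eb, incl_trans]

/-- A fully faithful inclusion preserving functor whose image is closed downwards along ideals is
a local isomorphism. -/
theorem isLocalIso_of_lift {F : C ⥤ D} [F.Full] [F.Faithful] (hF : PreservesInclusions F)
    (h : ∀ (c : C) (k : D), k ≤ F.obj c → ∃ b ≤ c, F.obj b = k) : IsLocalIso F := by
  refine ⟨inferInstance, inferInstance, hF, fun c => ⟨⟨?_, ?_⟩, ?_, ?_⟩⟩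
  · intro a b hab
    have e : F.obj a.obj = F.obj b.obj := congrArg ObjectProperty.FullSubcategory.obj hab
    have := le_antisymm (le_of_obj_le hF a.property b.property e.le)
      (le_of_obj_le hF b.property a.property e.ge)
    exact ObjectProperty.FullSubcategory.ext this
  · rintro ⟨k, hk⟩
    obtain ⟨b, hb, rfl⟩ := h c k hk
    exact ⟨⟨b, hb⟩, rfl⟩
  · unfold idealFunctor; infer_instance
  · unfold idealFunctor; infer_instance

end LocalIso

/-! ### Cross-connections from contravariant families of cones -/

/-- A family of idempotent normal cones `ε(c)` in `D`, indexed by the objects of `C`, whose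
vertices depend contravariantly on `c`. -/
structure ConeSystem (C : Type u) [Category.{v} C] (D : Type w) [Category.{z} D]
    [NormalCategory D] where
  cone : C → NormalCone D
  idem : ∀ c, IsIdempotentElem (cone c)
  hom : ∀ {a b : C}, (a ⟶ b) → ((cone b).vertex ⟶ (cone a).vertex)
  hom_id : ∀ a, hom (𝟙 a) = 𝟙 _
  hom_comp : ∀ {a b c : C} (f : a ⟶ b) (g : b ⟶ c), hom (f ≫ g) = hom g ≫ hom f

namespace ConeSystem

section

variable {C : Type u} [Category.{v} C] {D : Type w} [Category.{z} D] [NormalCategory D]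

/-- The functor `c ↦ H(ε(c);-)`. -/
noncomputable def functor (S : ConeSystem C D) : C ⥤ NormalDual D where
  obj c := ⟨HFunctor (S.cone c), _, S.idem c, rfl⟩
  map f := HFunctorHom (S.hom f)
  map_id a := HFunctor_hom_ext fun c f => by
    rw [HFunctorHom_app, S.hom_id, Category.id_comp]; rfl
  map_comp k l := HFunctor_hom_ext fun c f => by
    change _ = (HFunctorHom (S.hom l)).app c ((HFunctorHom (S.hom k)).app c _)
    rw [HFunctorHom_app, HFunctorHom_app, HFunctorHom_app, S.hom_comp, Category.assoc]

theorem functor_map_app (S : ConeSystem C D) {a b : C} (k : a ⟶ b) {c : D}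
    (f : (S.cone a).vertex ⟶ c) :
    ConeFunctor.Hom.app (S.functor.map k) c (starElem (S.cone a) f) =
      starElem (S.cone b) (S.hom k ≫ f) :=
  HFunctorHom_app (S.hom k) f

end

variable {C : Type u} [Category.{v} C] [NormalCategory C] {D : Type w} [Category.{z} D]
  [NormalCategory D]

/-- For `f = 1` the hypothesis puts the cone of `a` into the H-functor of `b`, which gives a
subfunctor; for general `f` it says that the induced transformation fixes every cone. -/
theorem preservesInclusions_functor (S : ConeSystem C D)
    (hincl : ∀ {a b : C} (h : a ≤ b) {d : D} (f : (S.cone a).vertex ⟶ d),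
      (S.cone b).star (S.hom (incl h) ≫ f) = (S.cone a).star f) :
    PreservesInclusions S.functor := by
  intro a b h
  have hm : S.cone a ∈ (HFunctor (S.cone b)).obj (S.cone a).vertex :=
    ⟨_, (hincl h (𝟙 _)).trans (S.cone a).star_id⟩
  exact ⟨HFunctor_le_of_mem hm, HFunctor_hom_ext fun c f =>
    (S.functor_map_app (incl h) f).trans (Subtype.ext (hincl h f))⟩

/-- Full faithfulness is Yoneda combined with `hbij`. A subobject `H(ε;-)` of the functor of `a` has
`ε = ε(a) * f°`; the factorization `hfac` turns this into `ε(b) * g°` with `g` a split monomorphism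
and `b ≤ a`, so `H(ε;-)` is the value at `b`. -/
theorem isCrossConnection_functor (S : ConeSystem C D)
    (hbij : ∀ a b : C, Function.Bijective (S.hom : (a ⟶ b) → _))
    (hincl : ∀ {a b : C} (h : a ≤ b) {d : D} (f : (S.cone a).vertex ⟶ d),
      (S.cone b).star (S.hom (incl h) ≫ f) = (S.cone a).star f)
    (hfac : ∀ (a : C) {d : D} (f : (S.cone a).vertex ⟶ d), ∃ (b : C) (h : b ≤ a)
      (g : (S.cone b).vertex ⟶ d), IsSplitMono g ∧ f = S.hom (incl h) ≫ g)
    (hM : ∀ d : D, ∃ c : C, IsIso ((S.cone c).app d)) :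
    IsCrossConnection S.functor := by
  have hmap : ∀ a b : C, Function.Bijective (S.functor.map : (a ⟶ b) → _) := fun a b =>
    (HFunctorHom_bijective (S.cone a) (S.cone b)).comp (hbij a b)
  have : S.functor.Full := ⟨fun {a b} => (hmap a b).2⟩
  have : S.functor.Faithful := ⟨fun {a b} _ _ e => (hmap a b).1 e⟩
  refine ⟨isLocalIso_of_lift (S.preservesInclusions_functor hincl) ?_, fun d => ?_⟩
  · rintro a ⟨_, ε, hε, rfl⟩ hk
    obtain ⟨f, hf⟩ : ε ∈ (HFunctor (S.cone a)).obj ε.vertex := hk.choose _ (mem_HFunctor_vertex ε)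
    obtain ⟨b, h, g, hg, e⟩ := hfac a f
    refine ⟨b, h, ?_⟩
    change NormalDual.mk _ _ = NormalDual.mk _ _
    congr 1
    rw [← hf, e, hincl h g, HFunctor_star_of_isSplitMono]
  · obtain ⟨c, hc⟩ := hM d
    exact ⟨c, S.cone c, S.idem c, rfl, hc⟩

end ConeSystem


/-! ### The functor `Δ_θ`: cones in `Π_θ` given by retractions onto `Aθ` -/

section SubsetCones

variable {X : Type u} {θ : X → X}

namespace PiTheta

/-- Composition in `Π_θ` reverses that of the mappings of classes, so a right inverse of the mapping
is a retraction of the morphism. -/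
theorem isSplitMono_of_surjective {π₁ π₂ : PiTheta θ} (f : π₁ ⟶ π₂)
    (hf : Function.Surjective (f : Quotient π₂.rel → Quotient π₁.rel)) : IsSplitMono f :=
  ⟨⟨⟨Function.surjInv hf, funext fun q => Function.surjInv_eq hf q⟩⟩⟩

theorem principalCone_app_vertex (e : X → X) (he : Saturates (Set.range θ) (Setoid.ker e))
    (hr : ∀ x, e (e x) = e x) :
    (principalCone e he).app (principalCone e he).vertex = 𝟙 (principalCone e he).vertex :=
  funext fun q => Quotient.inductionOn q fun x => Quotient.sound (hr x)

/-- Equal principal cones come from transformations that agree modulo all partitions in `Π_θ`. -/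
theorem rel_of_principalCone_eq {a b : X → X} {ha : Saturates (Set.range θ) (Setoid.ker a)}
    {hb : Saturates (Set.range θ) (Setoid.ker b)} (h : principalCone a ha = principalCone b hb)
    (τ : PiTheta θ) (x : X) : τ.rel (a x) (b x) := by
  -- Equal cones have vertices that are only propositionally equal; generalizing over `k` avoids a
  -- transport between the quotients.
  have key : ∀ k : InclCone (PiTheta θ), k = principalCone b hb →
      (k.app τ : Quotient k.vertex.rel → Quotient τ.rel) ⟦x⟧ = ⟦b x⟧ := by
    rintro _ rfl; rfl
  exact Quotient.exact (key _ h)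

/-- The normal cone given by an idempotent transformation. -/
def retractionCone (e : X → X) (he : Saturates (Set.range θ) (Setoid.ker e))
    (hr : ∀ x, e (e x) = e x) : NormalCone (PiTheta θ) where
  toCone := principalCone e he
  exists_isIso := ⟨_, by rw [principalCone_app_vertex e he hr]; infer_instance⟩

end PiTheta

open Classical in
/-- A retraction of `X` onto a nonempty subset. -/
noncomputable def setRetraction (D : Set X) (hD : D.Nonempty) (x : X) : X :=
  if x ∈ D then x else hD.some

theorem setRetraction_mem (D : Set X) (hD : D.Nonempty) (x : X) : setRetraction D hD x ∈ D := by
  unfold setRetraction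
  split_ifs with h
  exacts [h, hD.some_mem]

theorem setRetraction_of_mem {D : Set X} (hD : D.Nonempty) {x : X} (hx : x ∈ D) :
    setRetraction D hD x = x := if_pos hx

theorem range_setRetraction (D : Set X) (hD : D.Nonempty) : Set.range (setRetraction D hD) = D :=
  Set.Subset.antisymm (Set.range_subset_iff.2 (setRetraction_mem D hD))
    fun x hx => ⟨x, setRetraction_of_mem hD hx⟩

theorem saturates_ker_setRetraction {D : Set X} (hD : D.Nonempty) (h : D ⊆ Set.range θ) :
    Saturates (Set.range θ) (Setoid.ker (setRetraction D hD)) := fun x =>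
  ⟨_, h (setRetraction_mem D hD x), (setRetraction_of_mem hD (setRetraction_mem D hD x)).symm⟩

theorem theta_restrictEquiv_symm (A : PTheta θ) (y : θ '' A.carrier) :
    θ ((restrictEquiv A).symm y).1 = y.1 :=
  congrArg Subtype.val ((restrictEquiv A).apply_symm_apply y)

/-- The partition of `X` into a point of `Im θ` and its complement. -/
theorem saturates_ker_eq {y z : X} (hy : y ∈ Set.range θ) (hz : z ∈ Set.range θ) (h : z ≠ y) :
    Saturates (Set.range θ) (Setoid.ker fun x => x = y) := fun x => by
  by_cases hx : x = y
  · exact ⟨y, hy, by simp [hx]⟩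
  · exact ⟨z, hz, by simp [hx, h]⟩

/-- The singletons belong to `𝒫_θ`. -/
def PTheta.singleton (θ : X → X) (x : X) : PTheta θ :=
  ⟨{x}, ⟨x, rfl⟩, by rintro _ rfl _ rfl _; rfl⟩

/-- The idempotent cone in `Π_θ` given by a retraction onto a subset of `Im θ`. -/
noncomputable def subsetCone (D : Set X) (hD : D.Nonempty) (h : D ⊆ Set.range θ) :
    NormalCone (PiTheta θ) :=
  PiTheta.retractionCone (setRetraction D hD) (saturates_ker_setRetraction hD h) fun x =>
    setRetraction_of_mem hD (setRetraction_mem D hD x)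

theorem subsetCone_congr {D D' : Set X} {hD : D.Nonempty} {h : D ⊆ Set.range θ}
    {hD' : D'.Nonempty} {h' : D' ⊆ Set.range θ} (e : D = D') :
    subsetCone D hD h = subsetCone D' hD' h' := by
  subst e; rfl

/-- The idempotent cone given by a retraction onto `Aθ`. -/
noncomputable abbrev deltaCone (A : PTheta θ) : NormalCone (PiTheta θ) :=
  subsetCone (θ '' A.carrier) (A.nonempty.image θ) (Set.image_subset_range θ _)

/-- The vertex of the cone of `Aθ` is a partition with cross-section `Aθ`. -/
noncomputable def deltaVertexEquiv (A : PTheta θ) :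
    Quotient (deltaCone A).vertex.rel ≃ A.carrier where
  toFun := Quotient.lift (fun x => (restrictEquiv A).symm ⟨_, setRetraction_mem _
    (A.nonempty.image θ) x⟩) fun _ _ h => congrArg (restrictEquiv A).symm (Subtype.ext h)
  invFun a := ⟦θ a.1⟧
  left_inv q := by
    induction q using Quotient.inductionOn with | _ x => ?_
    have hx := setRetraction_mem _ (A.nonempty.image θ) x
    have : θ ((restrictEquiv A).symm ⟨_, hx⟩).1 = setRetraction _ _ x :=
      congrArg Subtype.val ((restrictEquiv A).apply_symm_apply ⟨_, hx⟩)
    refine Quotient.sound (s := Setoid.ker _) ?_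
    change setRetraction _ _ (θ ((restrictEquiv A).symm ⟨_, hx⟩).1) = _
    rw [this, setRetraction_of_mem _ hx]
  right_inv a := by
    change (restrictEquiv A).symm _ = a
    rw [Equiv.symm_apply_eq]
    exact Subtype.ext (setRetraction_of_mem _ ⟨a.1, a.2, rfl⟩)

theorem deltaVertexEquiv_mk (A : PTheta θ) {x : X} (hx : x ∈ θ '' A.carrier) :
    deltaVertexEquiv A ⟦x⟧ = (restrictEquiv A).symm ⟨x, hx⟩ :=
  congrArg (restrictEquiv A).symm (Subtype.ext (setRetraction_of_mem _ hx))

variable [Nonempty X]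

namespace PiTheta

theorem isSplitEpi_of_injective {π₁ π₂ : PiTheta θ} (f : π₁ ⟶ π₂)
    (hf : Function.Injective (f : Quotient π₂.rel → Quotient π₁.rel)) : IsSplitEpi f := by
  have : Nonempty (Quotient π₂.rel) := ‹Nonempty X›.map fun x => ⟦x⟧
  exact ⟨⟨⟨Function.invFun (f : Quotient π₂.rel → Quotient π₁.rel),
    funext fun q => Function.leftInverse_invFun hf q⟩⟩⟩

theorem isIdempotentElem_retractionCone (e : X → X)
    (he : Saturates (Set.range θ) (Setoid.ker e)) (hr : ∀ x, e (e x) = e x) :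
    IsIdempotentElem (retractionCone e he hr) :=
  NormalCone.isIdempotentElem_of_app_vertex (principalCone_app_vertex e he hr)

/-- Since `e` fixes the values of `c`, the `ker e`-class of `c x` determines `c x`. Hence `f`
factors through the partition `ker c` by an injective mapping of classes, which is a split
epimorphism of `Π_θ`, and the components of the resulting cone are those of `c`. -/
theorem star_retractionCone {e : X → X} {he : Saturates (Set.range θ) (Setoid.ker e)}
    {hr : ∀ x, e (e x) = e x} {σ : PiTheta θ} (f : (retractionCone e he hr).vertex ⟶ σ)
    (c : X → X) (hc : Saturates (Set.range θ) (Setoid.ker c)) (hec : ∀ x, e (c x) = c x)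
    (hf : ∀ x, (f : Quotient σ.rel → Quotient (Setoid.ker e)) ⟦x⟧ = ⟦c x⟧) :
    ((retractionCone e he hr).star f).toCone = principalCone c hc := by
  have hσ : σ.rel ≤ Setoid.ker c := fun x y h => by
    have h₁ : (⟦c x⟧ : Quotient (Setoid.ker e)) = ⟦c y⟧ :=
      (hf x).symm.trans ((congrArg f (Quotient.sound h)).trans (hf y))
    have h₂ : e (c x) = e (c y) := Quotient.exact h₁
    rwa [hec, hec] at h₂
  let g : Quotient (Setoid.ker c) → Quotient (Setoid.ker e) :=
    Quotient.lift (fun x => ⟦c x⟧) fun _ _ h => congrArg _ h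
  have hg : Function.Injective g := by
    intro a b
    induction a using Quotient.inductionOn with | _ x => ?_
    induction b using Quotient.inductionOn with | _ y => ?_
    intro h
    have h₂ : e (c x) = e (c y) := Quotient.exact h
    rw [hec, hec] at h₂
    exact Quotient.sound h₂
  let g' : (retractionCone e he hr).vertex ⟶ (⟨Setoid.ker c, hc⟩ : PiTheta θ) := g
  have : IsSplitEpi g' := isSplitEpi_of_injective _ hg
  have hle : (⟨Setoid.ker c, hc⟩ : PiTheta θ) ≤ σ := bar_subset_bar_iff.2 hσ
  rw [NormalCone.star_toCone _ hle g' (funext fun q => Quotient.inductionOn q hf)]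
  change InclCone.mk _ _ _ = InclCone.mk _ _ _
  congr 1
  funext τ q
  induction q using Quotient.inductionOn with | _ x => ?_
  change (⟦e (c x)⟧ : Quotient τ.rel) = ⟦c x⟧
  rw [hec]

end PiTheta

theorem star_deltaCone (A : PTheta θ) {σ : PiTheta θ} (f : (deltaCone A).vertex ⟶ σ) (c : X → X)
    (hc : Saturates (Set.range θ) (Setoid.ker c))
    (hf : ∀ x, θ (deltaVertexEquiv A ((f : Quotient σ.rel → Quotient (deltaCone A).vertex.rel)
      ⟦x⟧)).1 = c x) :
    ((deltaCone A).star f).toCone = PiTheta.principalCone c hc := by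
  refine PiTheta.star_retractionCone f c hc (fun x => setRetraction_of_mem _ ?_) fun x => ?_
  · rw [← hf]
    exact ⟨_, Subtype.prop _, rfl⟩
  · rw [← hf]
    exact ((deltaVertexEquiv A).symm_apply_apply _).symm

/-- The transformation is read off `f`: it sends `x` to the point of `Aθ` in the class `f ⟦x⟧`. -/
theorem exists_star_deltaCone (A : PTheta θ) {σ : PiTheta θ} (f : (deltaCone A).vertex ⟶ σ) :
    ∃ (c : X → X) (hc : Saturates (Set.range θ) (Setoid.ker c)),
      (∀ x, θ (deltaVertexEquiv A ((f : Quotient σ.rel → Quotient (deltaCone A).vertex.rel)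
        ⟦x⟧)).1 = c x) ∧ ((deltaCone A).star f).toCone = PiTheta.principalCone c hc := by
  have hc : Saturates (Set.range θ) (Setoid.ker fun x => θ (deltaVertexEquiv A
      ((f : Quotient σ.rel → Quotient (deltaCone A).vertex.rel) ⟦x⟧)).1) :=
    σ.saturates.mono fun x y h => by
      change θ _ = θ _
      rw [Quotient.sound h]
  exact ⟨_, hc, fun _ => rfl, star_deltaCone A f _ hc fun _ => rfl⟩

/-- The system of cones of the subsets `Aθ`. -/
noncomputable def deltaSystem (θ : X → X) : ConeSystem (PTheta θ) (PiTheta θ) where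
  cone := deltaCone
  idem A := PiTheta.isIdempotentElem_retractionCone _ _ _
  hom {A B} f := fun q : Quotient (deltaCone A).vertex.rel =>
    (deltaVertexEquiv B).symm (f (deltaVertexEquiv A q))
  hom_id A := funext fun q => (deltaVertexEquiv A).symm_apply_apply q
  hom_comp {A B D} f g := funext fun q => by
    change _ = (deltaVertexEquiv D).symm (g (deltaVertexEquiv B ((deltaVertexEquiv B).symm _)))
    rw [Equiv.apply_symm_apply]
    rfl

theorem deltaSystem_hom_bijective (A B : PTheta θ) :
    Function.Bijective ((deltaSystem θ).hom : (A ⟶ B) → _) :=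
  (Equiv.arrowCongr (deltaVertexEquiv A).symm (deltaVertexEquiv B).symm).bijective

/-- The identification of the vertex with `B` cancels, leaving a transformation that involves only
`k` and `θ`. When `k` is an inclusion it is the transformation of `f` itself, which is the
compatibility with inclusions. -/
theorem star_deltaSystem_hom {A B : PTheta θ} (k : A ⟶ B) {σ : PiTheta θ}
    (f : (deltaCone A).vertex ⟶ σ) (c : X → X) (hc : Saturates (Set.range θ) (Setoid.ker c))
    (hf : ∀ x, θ (k (deltaVertexEquiv A
      ((f : Quotient σ.rel → Quotient (deltaCone A).vertex.rel) ⟦x⟧))).1 = c x) :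
    ((deltaCone B).star ((deltaSystem θ).hom k ≫ f)).toCone = PiTheta.principalCone c hc := by
  refine star_deltaCone B _ c hc fun x => ?_
  rw [← hf]
  change θ (deltaVertexEquiv B ((deltaVertexEquiv B).symm _)).1 = _
  rw [Equiv.apply_symm_apply]

/-- `Im θ` meets every class of `π`; one `θ`-preimage chosen per class gives a set `A` such that
`Aθ` is a cross-section of `π`. -/
theorem exists_isIso_deltaCone (π : PiTheta θ) : ∃ A : PTheta θ, IsIso ((deltaCone A).app π) := by
  have h : ∀ q : Quotient π.rel, ∃ x, (⟦θ x⟧ : Quotient π.rel) = q := fun q => by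
    induction q using Quotient.inductionOn with | _ y => ?_
    obtain ⟨_, ⟨x, rfl⟩, hx⟩ := π.saturates y
    exact ⟨x, Quotient.sound (π.rel.symm' hx)⟩
  choose s hs using h
  let A : PTheta θ := ⟨Set.range s, ‹Nonempty X›.elim fun x => ⟨_, ⟦x⟧, rfl⟩, by
    rintro _ ⟨p, rfl⟩ _ ⟨q, rfl⟩ (hpq : θ (s p) = θ (s q))
    rw [← hs p, ← hs q, hpq]⟩
  refine ⟨A, PiTheta.isIso_of_bijective _ ?_⟩
  have key : ∀ a : A.carrier, ((deltaCone A).app π : Quotient (deltaCone A).vertex.rel →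
      Quotient π.rel) ((deltaVertexEquiv A).symm a) = ⟦θ a.1⟧ := fun a =>
    congrArg (fun x => (⟦x⟧ : Quotient π.rel)) (setRetraction_of_mem _ ⟨a.1, a.2, rfl⟩)
  rw [← (deltaVertexEquiv A).symm.bijective.of_comp_iff]
  constructor
  · rintro ⟨_, p, rfl⟩ ⟨_, q, rfl⟩ h
    simp only [Function.comp_apply, key, hs] at h
    rw [h]
  · intro q
    exact ⟨⟨s q, q, rfl⟩, (key _).trans (hs q)⟩

theorem isCrossConnection_delta (θ : X → X) : IsCrossConnection (deltaSystem θ).functor := by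
  refine ConeSystem.isCrossConnection_functor _ deltaSystem_hom_bijective ?_ ?_
    exists_isIso_deltaCone
  · intro A B h σ f
    obtain ⟨c, hc, hf, e⟩ := exists_star_deltaCone A f
    exact NormalCone.ext ((star_deltaSystem_hom (incl h) f c hc hf).trans e.symm)
  · intro A σ f
    let f' : Quotient σ.rel → Quotient (deltaCone A).vertex.rel := f
    have hB : Subtype.val '' Set.range (fun q => deltaVertexEquiv A (f' q)) ⊆ A.carrier := by
      rintro _ ⟨x, -, rfl⟩; exact x.2
    -- `B` is the part of `A` that `f` hits, so `f` becomes surjective on classes, that is, a split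
    -- monomorphism, over `B`.
    let B : PTheta θ := ⟨Subtype.val '' Set.range fun q => deltaVertexEquiv A (f' q),
      ‹Nonempty X›.elim fun x => ⟨_, _, ⟨⟦x⟧, rfl⟩, rfl⟩, A.separates.mono hB⟩
    let g : Quotient σ.rel → Quotient (deltaCone B).vertex.rel := fun q =>
      (deltaVertexEquiv B).symm ⟨_, _, ⟨q, rfl⟩, rfl⟩
    refine ⟨B, hB, g, PiTheta.isSplitMono_of_surjective (π₁ := (deltaCone B).vertex) g ?_,
      funext fun q => ?_⟩
    · intro p
      obtain ⟨⟨_, _, ⟨q, rfl⟩, rfl⟩, rfl⟩ := (deltaVertexEquiv B).symm.surjective p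
      exact ⟨q, rfl⟩
    · change f' q = (deltaVertexEquiv A).symm (incl (show B ≤ A from hB)
        (deltaVertexEquiv B ((deltaVertexEquiv B).symm _)))
      rw [Equiv.apply_symm_apply]
      exact ((deltaVertexEquiv A).symm_apply_apply _).symm

theorem isSubsetObj_delta (A : PTheta θ) :
    IsSubsetObj ((deltaSystem θ).functor.obj A) (θ '' A.carrier) :=
  ⟨deltaCone A, (deltaSystem θ).idem A, rfl, _, _, range_setRetraction _ (A.nonempty.image θ), rfl⟩

theorem isSubsetHom_delta {A B : PTheta θ} (f : A ⟶ B) :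
    IsSubsetHom ((deltaSystem θ).functor.map f) (deltaMap f) := by
  intro σ c hc
  -- The morphism whose cone is the one given by `c`: the class of `x` goes to the vertex class that
  -- contains `c x`.
  let k : Quotient σ.rel → Quotient (deltaCone A).vertex.rel :=
    Quotient.lift (fun x => ⟦(c x).1⟧) fun x y h => by
      rw [show c x = c y from hc h]
  have hk : ∀ x, deltaVertexEquiv A (k ⟦x⟧) = (restrictEquiv A).symm (c x) := fun x =>
    deltaVertexEquiv_mk A (c x).2
  refine ⟨starElem (deltaCone A) (show (deltaCone A).vertex ⟶ σ from k), ?_, ?_⟩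
  · refine star_deltaCone A _ _ _ fun x => ?_
    exact (congrArg (fun a : A.carrier => θ a.1) (hk x)).trans (theta_restrictEquiv_symm A _)
  · refine (congrArg (fun x => x.1.toCone) ((deltaSystem θ).functor_map_app f
      (show (deltaCone A).vertex ⟶ σ from k))).trans (star_deltaSystem_hom f _ _ _ fun x => ?_)
    exact congrArg (fun a : A.carrier => θ (f a).1) (hk x)

theorem not_isCategoryIso_delta (hθ : ¬ Function.Bijective θ) :
    ¬ IsCategoryIso (deltaSystem θ).functor := by
  rintro ⟨⟨hinj, hsurj⟩, -⟩
  have hθi : Function.Injective θ := by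
    intro x y hxy
    -- Singletons always lie in `𝒫_θ`, and `{x}`, `{y}` have the same image under `θ`.
    have h : deltaCone (PTheta.singleton θ x) = deltaCone (PTheta.singleton θ y) :=
      subsetCone_congr (by simp [PTheta.singleton, hxy])
    have := @hinj (PTheta.singleton θ x) (PTheta.singleton θ y) (by
      change NormalDual.mk _ _ = NormalDual.mk _ _
      congr 1
      exact congrArg HFunctor h)
    exact Set.singleton_injective (congrArg PTheta.carrier this)
  refine hθ ⟨hθi, fun z => ?_⟩
  by_contra hz
  obtain ⟨x₀⟩ := ‹Nonempty X›
  -- The constant mapping onto a point outside `Im θ`; its kernel has one class, so it gives a cone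
  -- in `Π_θ`.
  let ε : NormalCone (PiTheta θ) := PiTheta.retractionCone (fun _ => z)
    (fun _ => ⟨θ x₀, ⟨x₀, rfl⟩, rfl⟩) fun _ => rfl
  obtain ⟨A, hA⟩ := hsurj ⟨HFunctor ε, ε, PiTheta.isIdempotentElem_retractionCone _ _ _, rfl⟩
  have hA' : HFunctor (deltaCone A) = HFunctor ε := congrArg NormalDual.functor hA
  obtain ⟨f, hf⟩ : ε ∈ (HFunctor (deltaCone A)).obj ε.vertex := by
    rw [hA']; exact mem_HFunctor_vertex ε
  obtain ⟨c, hc, hfc, e⟩ := exists_star_deltaCone A f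
  have hcε : PiTheta.principalCone c hc = ε.toCone := by rw [← e, hf]
  have hrange : c x₀ ∈ Set.range θ := by rw [← hfc]; exact ⟨_, rfl⟩
  have hzc : z ≠ c x₀ := fun h => hz (h ▸ hrange)
  -- A second point of `Im θ`, so that `{c x₀}` and its complement form a partition in `Π_θ`. It
  -- exists because an injective constant `θ` would leave only one point in `X`. This partition
  -- separates `c x₀` from `z`, although the equal cones of `c` and of the constant `z` must agree
  -- modulo it.
  obtain ⟨y, hy⟩ : ∃ y, θ y ≠ c x₀ := by
    by_contra! hall
    exact hzc (hθi ((hall z).trans (hall (c x₀)).symm))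
  have h₁ := PiTheta.rel_of_principalCone_eq hcε
    ⟨_, saturates_ker_eq hrange ⟨y, rfl⟩ hy⟩ x₀
  have h₂ : (c x₀ = c x₀) = (z = c x₀) := h₁
  exact hzc (h₂ ▸ rfl)

end SubsetCones


/-! ### The functor `Γ_θ`: cones in `𝒫_θ` given by retractions with kernel `πθ⁻¹` -/

section PartitionCones

variable {X : Type u} {θ : X → X}

namespace PTheta

theorem isSplitMono_of_injective {A B : PTheta θ} (f : A ⟶ B)
    (hf : Function.Injective (f : A.carrier → B.carrier)) : IsSplitMono f := by
  have : Nonempty A.carrier := A.nonempty.to_subtype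
  exact ⟨⟨⟨Function.invFun (f : A.carrier → B.carrier),
    funext fun x => Function.leftInverse_invFun hf x⟩⟩⟩

theorem isSplitEpi_of_surjective {A B : PTheta θ} (f : A ⟶ B)
    (hf : Function.Surjective (f : A.carrier → B.carrier)) : IsSplitEpi f :=
  ⟨⟨⟨Function.surjInv hf, funext fun x => Function.surjInv_eq hf x⟩⟩⟩

variable [Nonempty X]

theorem principalCone_app_vertex (e : X → X) (he : Separates (Setoid.ker θ) (Set.range e))
    (hr : ∀ x, e (e x) = e x) :
    (principalCone e he).app (principalCone e he).vertex = 𝟙 (principalCone e he).vertex := by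
  funext x
  obtain ⟨_, x, rfl⟩ := x
  exact Subtype.ext (hr x)

/-- A transformation is determined by its cone in `𝒫_θ`. -/
theorem eq_of_principalCone_eq {a b : X → X} {ha : Separates (Setoid.ker θ) (Set.range a)}
    {hb : Separates (Setoid.ker θ) (Set.range b)} (h : principalCone a ha = principalCone b hb)
    (x : X) : a x = b x := by
  -- The singleton `{x}` is an object of `𝒫_θ`, so the component there reads off the value at `x`.
  have key : ∀ k : InclCone (PTheta θ), k = principalCone b hb →
      ((k.app (singleton θ x) : (singleton θ x).carrier → k.vertex.carrier) ⟨x, rfl⟩).1 = b x := by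
    rintro _ rfl; rfl
  exact key _ h

/-- The normal cone given by an idempotent transformation. -/
def retractionCone (e : X → X) (he : Separates (Setoid.ker θ) (Set.range e))
    (hr : ∀ x, e (e x) = e x) : NormalCone (PTheta θ) where
  toCone := principalCone e he
  exists_isIso := ⟨_, by rw [principalCone_app_vertex e he hr]; infer_instance⟩

theorem isIdempotentElem_retractionCone (e : X → X)
    (he : Separates (Setoid.ker θ) (Set.range e)) (hr : ∀ x, e (e x) = e x) :
    IsIdempotentElem (retractionCone e he hr) :=
  NormalCone.isIdempotentElem_of_app_vertex (principalCone_app_vertex e he hr)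

theorem star_retractionCone {e : X → X} {he : Separates (Setoid.ker θ) (Set.range e)}
    {hr : ∀ x, e (e x) = e x} {A : PTheta θ} (f : (retractionCone e he hr).vertex ⟶ A)
    (c : X → X) (hc : Separates (Setoid.ker θ) (Set.range c))
    (hf : ∀ x, ((f : Set.range e → A.carrier) ⟨e x, x, rfl⟩).1 = c x) :
    ((retractionCone e he hr).star f).toCone = principalCone c hc := by
  obtain rfl : (fun x => ((f : Set.range e → A.carrier) ⟨e x, x, rfl⟩).1) = c := funext hf
  let B : PTheta θ := ⟨_, Set.range_nonempty _, hc⟩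
  let g : (retractionCone e he hr).vertex ⟶ B := fun x => ⟨(f x).1, by
    obtain ⟨_, y, rfl⟩ := x
    exact ⟨y, rfl⟩⟩
  have : IsSplitEpi g := isSplitEpi_of_surjective _ <| by
    rintro ⟨_, y, rfl⟩
    exact ⟨⟨e y, y, rfl⟩, rfl⟩
  have hle : B ≤ A := Set.range_subset_iff.2 fun y => Subtype.prop _
  exact NormalCone.star_toCone _ hle g rfl

end PTheta

/-- Representatives with equal `θ`-values lie in one `ρ`-class, because `ker θ ≤ ρ`, and therefore
coincide. -/
theorem range_out_separates (ρ : Setoid X) (h : Setoid.ker θ ≤ ρ) :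
    Separates (Setoid.ker θ) (Set.range fun x => (⟦x⟧ : Quotient ρ).out) := by
  rintro _ ⟨x, rfl⟩ _ ⟨y, rfl⟩ hxy
  have := Quotient.sound (s := ρ) (h hxy)
  rw [Quotient.out_eq, Quotient.out_eq] at this
  exact congrArg Quotient.out this

theorem ker_le_comap (ρ : Setoid X) : Setoid.ker θ ≤ ρ.comap θ := fun x y h => by
  change ρ (θ x) (θ y)
  rw [show θ x = θ y from h]

/-- The class of `xθ` for the representative `x` of a class of `πθ⁻¹`. -/
theorem mk_theta_out (π : Setoid X) (x : X) :
    (⟦θ (⟦x⟧ : Quotient (π.comap θ)).out⟧ : Quotient π) = ⟦θ x⟧ :=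
  Quotient.sound (Quotient.mk_out (s := π.comap θ) x)

theorem out_eq_of_mk_theta_eq {π : Setoid X} {x y : X}
    (h : (⟦θ x⟧ : Quotient π) = ⟦θ y⟧) :
    (⟦x⟧ : Quotient (π.comap θ)).out = (⟦y⟧ : Quotient (π.comap θ)).out :=
  congrArg Quotient.out (Quotient.sound (s := π.comap θ) (Quotient.exact (s := π) h))

/-- This fixes the values of `gammaMap` up to `π₁θ⁻¹`, which is why the cross-section `C` does not
affect the resulting natural transformation. -/
theorem mk_theta_gammaMap {π₁ π₂ : PiTheta θ} (η : π₁ ⟶ π₂) (C : PTheta θ)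
    (hC : IsCrossSection C.carrier (π₁.rel.comap θ)) (x : X) :
    (⟦θ (gammaMap η C hC x)⟧ : Quotient π₁.rel) = η ⟦θ x⟧ := by
  exact (congrArg (fun y => (⟦y⟧ : Quotient π₁.rel)) (theta_restrictEquiv_symm C _)).trans
    ((Equiv.ofBijective _ (isCrossSection_image π₁ hC)).apply_symm_apply _)

variable [Nonempty X]

/-- The idempotent cone in `𝒫_θ` given by a retraction with kernel `ρ`. -/
noncomputable def partitionCone (ρ : Setoid X) (h : Setoid.ker θ ≤ ρ) : NormalCone (PTheta θ) :=
  PTheta.retractionCone (fun x => (⟦x⟧ : Quotient ρ).out) (range_out_separates ρ h) fun x => by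
    rw [Quotient.out_eq]

theorem partitionCone_congr {ρ ρ' : Setoid X} {h : Setoid.ker θ ≤ ρ} {h' : Setoid.ker θ ≤ ρ'}
    (e : ρ = ρ') : partitionCone ρ h = partitionCone ρ' h' := by
  subst e; rfl

/-- The idempotent cone given by a retraction with kernel `πθ⁻¹`. -/
noncomputable abbrev gammaCone (π : PiTheta θ) : NormalCone (PTheta θ) :=
  partitionCone (π.rel.comap θ) (ker_le_comap π.rel)

/-- The representative of a class of `πθ⁻¹`, as an element of the vertex of the cone. -/
noncomputable def gammaRep (π : PiTheta θ) (x : X) : (gammaCone π).vertex.carrier :=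
  ⟨(⟦x⟧ : Quotient (π.rel.comap θ)).out, x, rfl⟩

/-- The image of the vertex of the cone of `πθ⁻¹` under `θ` is a cross-section of `π`. -/
noncomputable def gammaVertexEquiv (π : PiTheta θ) :
    (gammaCone π).vertex.carrier ≃ Quotient π.rel :=
  Equiv.ofBijective (fun x => ⟦θ x.1⟧) <| by
    constructor
    · rintro ⟨_, x, rfl⟩ ⟨_, y, rfl⟩ h
      apply Subtype.ext
      change (⟦θ (⟦x⟧ : Quotient (π.rel.comap θ)).out⟧ : Quotient π.rel) =
        ⟦θ (⟦y⟧ : Quotient (π.rel.comap θ)).out⟧ at h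
      rw [mk_theta_out, mk_theta_out] at h
      exact out_eq_of_mk_theta_eq h
    · intro q
      induction q using Quotient.inductionOn with | _ y => ?_
      obtain ⟨_, ⟨x, rfl⟩, hx⟩ := π.saturates y
      exact ⟨gammaRep π x, (mk_theta_out π.rel x).trans (Quotient.sound (π.rel.symm' hx))⟩

theorem gammaVertexEquiv_rep (π : PiTheta θ) (x : X) :
    gammaVertexEquiv π (gammaRep π x) = ⟦θ x⟧ := mk_theta_out π.rel x

theorem star_gammaCone (π : PiTheta θ) {A : PTheta θ} (f : (gammaCone π).vertex ⟶ A) (c : X → X)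
    (hc : Separates (Setoid.ker θ) (Set.range c)) (hf : ∀ x, (f (gammaRep π x)).1 = c x) :
    ((gammaCone π).star f).toCone = PTheta.principalCone c hc :=
  PTheta.star_retractionCone f c hc hf

theorem exists_star_gammaCone (π : PiTheta θ) {A : PTheta θ} (f : (gammaCone π).vertex ⟶ A) :
    ∃ (c : X → X) (hc : Separates (Setoid.ker θ) (Set.range c)),
      (∀ x, (f (gammaRep π x)).1 = c x) ∧
        ((gammaCone π).star f).toCone = PTheta.principalCone c hc := by
  have hc : Separates (Setoid.ker θ) (Set.range fun x => (f (gammaRep π x)).1) :=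
    A.separates.mono (Set.range_subset_iff.2 fun x => Subtype.prop _)
  exact ⟨_, hc, fun _ => rfl, star_gammaCone π f _ hc fun _ => rfl⟩

/-- The system of cones of the partitions `πθ⁻¹`. -/
noncomputable def gammaSystem (θ : X → X) : ConeSystem (PiTheta θ) (PTheta θ) where
  cone := gammaCone
  idem π := PTheta.isIdempotentElem_retractionCone _ _ _
  hom {π₁ π₂} η := fun x => (gammaVertexEquiv π₁).symm (η (gammaVertexEquiv π₂ x))
  hom_id π := funext fun x => (gammaVertexEquiv π).symm_apply_apply x
  hom_comp {π₁ π₂ π₃} η ζ := funext fun x => by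
    change _ = (gammaVertexEquiv π₁).symm (η (gammaVertexEquiv π₂ ((gammaVertexEquiv π₂).symm _)))
    rw [Equiv.apply_symm_apply]
    rfl

theorem gammaSystem_hom_bijective (π₁ π₂ : PiTheta θ) :
    Function.Bijective ((gammaSystem θ).hom : (π₁ ⟶ π₂) → _) :=
  (Equiv.arrowCongr (gammaVertexEquiv π₂).symm (gammaVertexEquiv π₁).symm).bijective

theorem star_gammaSystem_hom {π₁ π₂ : PiTheta θ} (η : π₁ ⟶ π₂) {A : PTheta θ}
    (f : (gammaCone π₁).vertex ⟶ A) (c : X → X) (hc : Separates (Setoid.ker θ) (Set.range c))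
    (hf : ∀ x, (f ((gammaVertexEquiv π₁).symm (η ⟦θ x⟧))).1 = c x) :
    ((gammaCone π₂).star ((gammaSystem θ).hom η ≫ f)).toCone = PTheta.principalCone c hc := by
  refine star_gammaCone π₂ _ c hc fun x => ?_
  rw [← hf, ← gammaVertexEquiv_rep π₂ x]
  rfl

/-- For `π` the kernel of a retraction onto `Aθ`, the set `Aθ` is a cross-section of `π`.
Identifying the vertex with the classes of `π` turns the component at `A` into `a ↦ ⟦θ a⟧`, which is
bijective because `θ` is injective on `A`. -/
theorem exists_isIso_gammaCone (A : PTheta θ) : ∃ π : PiTheta θ, IsIso ((gammaCone π).app A) := by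
  have hA := A.nonempty.image θ
  let π : PiTheta θ := ⟨_, saturates_ker_setRetraction hA (Set.image_subset_range θ _)⟩
  refine ⟨π, PTheta.isIso_of_bijective _ ?_⟩
  have key : ∀ a : A.carrier, gammaVertexEquiv π ((gammaCone π).app A a) = ⟦θ a.1⟧ := fun a =>
    gammaVertexEquiv_rep π a.1
  have hmem : ∀ a : A.carrier, θ a.1 ∈ θ '' A.carrier := fun a => ⟨a.1, a.2, rfl⟩
  rw [← (gammaVertexEquiv π).bijective.of_comp_iff']
  constructor
  · intro a b h
    simp only [Function.comp_apply, key] at h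
    have h' : setRetraction _ hA (θ a.1) = setRetraction _ hA (θ b.1) := Quotient.exact h
    rw [setRetraction_of_mem hA (hmem a), setRetraction_of_mem hA (hmem b)] at h'
    exact Subtype.ext (A.separates _ a.2 _ b.2 h')
  · intro q
    induction q using Quotient.inductionOn with | _ y => ?_
    obtain ⟨a, ha, hay⟩ := setRetraction_mem _ hA y
    refine ⟨⟨a, ha⟩, (key _).trans (Quotient.sound (s := Setoid.ker _) ?_)⟩
    change setRetraction _ hA (θ a) = _
    rw [hay, setRetraction_of_mem hA (setRetraction_mem _ hA y)]

theorem isCrossConnection_gamma (θ : X → X) : IsCrossConnection (gammaSystem θ).functor := by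
  refine ConeSystem.isCrossConnection_functor _ gammaSystem_hom_bijective ?_ ?_
    exists_isIso_gammaCone
  · intro π₁ π₂ h A f
    obtain ⟨c, hc, hf, e⟩ := exists_star_gammaCone π₁ f
    refine NormalCone.ext ((star_gammaSystem_hom (incl h) f c hc fun x => ?_).trans e.symm)
    rw [← hf]
    exact congrArg (fun y => (f y).1)
      ((Equiv.symm_apply_eq _).2 (gammaVertexEquiv_rep π₁ x).symm)
  · intro π A f
    let k : Quotient π.rel → A.carrier := fun q => f ((gammaVertexEquiv π).symm q)
    have hπ : π.rel ≤ Setoid.ker fun x => k ⟦x⟧ := fun x y h => congrArg k (Quotient.sound h)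
    -- `σ` merges the classes of `π` on which `f` agrees, so the induced mapping `k'` is injective
    -- and yields a split monomorphism.
    let σ : PiTheta θ := ⟨_, π.saturates.mono hπ⟩
    let k' : Quotient σ.rel → A.carrier := Quotient.lift (fun x => k ⟦x⟧) fun _ _ h => h
    have hk' : Function.Injective k' := by
      intro p q
      induction p using Quotient.inductionOn with | _ x => ?_
      induction q using Quotient.inductionOn with | _ y => ?_
      exact fun h => Quotient.sound h
    have hle : σ ≤ π := PiTheta.bar_subset_bar_iff.2 hπ
    refine ⟨σ, hle, fun x => k' (gammaVertexEquiv σ x), PTheta.isSplitMono_of_injective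
      (A := (gammaCone σ).vertex) _ (hk'.comp (gammaVertexEquiv σ).injective), funext fun x => ?_⟩
    change f x = k' (gammaVertexEquiv σ ((gammaVertexEquiv σ).symm (incl hle
      (gammaVertexEquiv π x))))
    rw [Equiv.apply_symm_apply]
    exact (congrArg f ((gammaVertexEquiv π).symm_apply_apply x)).symm

theorem isPartitionObj_gamma (π : PiTheta θ) :
    IsPartitionObj ((gammaSystem θ).functor.obj π) (π.rel.comap θ) := by
  refine ⟨gammaCone π, (gammaSystem θ).idem π, rfl, _, _, ?_, rfl⟩
  ext x y
  change (⟦x⟧ : Quotient (π.rel.comap θ)).out = (⟦y⟧ : Quotient (π.rel.comap θ)).out ↔ _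
  rw [Quotient.out_inj, Quotient.eq]

theorem isPartitionHom_gamma {π₁ π₂ : PiTheta θ} (η : π₁ ⟶ π₂) (C : PTheta θ)
    (hC : IsCrossSection C.carrier (π₁.rel.comap θ)) :
    IsPartitionHom ((gammaSystem θ).functor.map η) (π₁.rel.comap θ) (gammaMap η C hC) := by
  intro A a ha
  let f : (gammaCone π₁).vertex ⟶ A := fun x => a x.1
  refine ⟨starElem (gammaCone π₁) f, ?_, ?_⟩
  · exact star_gammaCone π₁ f _ _ fun x => congrArg Subtype.val
      (ha (Quotient.mk_out (s := π₁.rel.comap θ) x))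
  · refine (congrArg (fun x => x.1.toCone) ((gammaSystem θ).functor_map_app η f)).trans
      (star_gammaSystem_hom η f _ _ fun x => congrArg Subtype.val (ha ?_))
    -- The chosen representative and the value of `gammaMap` both have their `θ`-image in the class
    -- `η ⟦θ x⟧`, and `a` is constant on the classes of `π₁θ⁻¹`.
    refine Quotient.exact (s := π₁.rel) ?_
    rw [mk_theta_gammaMap]
    exact (gammaVertexEquiv π₁).apply_symm_apply _

theorem not_isCategoryIso_gamma (hθ : ¬ Function.Bijective θ) (hc : ∃ x y : X, θ x ≠ θ y) :
    ¬ IsCategoryIso (gammaSystem θ).functor := by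
  rintro ⟨⟨hinj, hsurj⟩, -⟩
  refine hθ ⟨fun x y hxy => ?_, fun z => ?_⟩
  · by_contra hne
    obtain ⟨w, hw⟩ : ∃ w, θ w ≠ θ x := by
      by_contra! h
      obtain ⟨a, b, hab⟩ := hc
      exact hab ((h a).trans (h b).symm)
    have hwx : w ≠ x := fun h => hw (congrArg θ h)
    classical
    -- An idempotent with image `{x, w}`, which `ker θ` separates, but whose kernel does not relate
    -- `x` and `y`. Every transformation that arises from `gammaCone π` is constant on the classes
    -- of `ker θ`, so this cone's H-functor is not a value of `Γ_θ`.
    let e : X → X := fun t => if t = x then x else w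
    have he : Separates (Setoid.ker θ) (Set.range e) := by
      rintro _ ⟨s, rfl⟩ _ ⟨t, rfl⟩ (hst : θ (e s) = θ (e t))
      simp only [e] at hst ⊢
      split_ifs at hst ⊢ with h₁ h₂ h₂
      exacts [rfl, absurd hst.symm hw, absurd hst hw, rfl]
    have hr : ∀ t, e (e t) = e t := fun t => by
      by_cases h : t = x <;> simp [e, h, hwx]
    let ε : NormalCone (PTheta θ) := PTheta.retractionCone e he hr
    obtain ⟨π, hπ⟩ := hsurj ⟨HFunctor ε, ε, PTheta.isIdempotentElem_retractionCone _ _ _, rfl⟩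
    have hπ' : HFunctor (gammaCone π) = HFunctor ε := congrArg NormalDual.functor hπ
    obtain ⟨f, hf⟩ : ε ∈ (HFunctor (gammaCone π)).obj ε.vertex := by
      rw [hπ']; exact mem_HFunctor_vertex ε
    obtain ⟨c, hc, hfc, h⟩ := exists_star_gammaCone π f
    have hcε : PTheta.principalCone c hc = PTheta.principalCone e he :=
      h.symm.trans (congrArg NormalCone.toCone hf)
    have hxy' : gammaRep π x = gammaRep π y :=
      Subtype.ext (out_eq_of_mk_theta_eq (congrArg _ hxy))
    have : e x = e y := by
      rw [← PTheta.eq_of_principalCone_eq hcε, ← PTheta.eq_of_principalCone_eq hcε, ← hfc, ← hfc,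
        hxy']
    simp only [e, if_pos, if_neg (Ne.symm hne)] at this
    exact hwx this.symm
  · by_contra hz
    obtain ⟨x, y, hxy⟩ := hc
    have hzx : z ≠ θ x := fun h => hz ⟨x, h.symm⟩
    have hzy : z ≠ θ y := fun h => hz ⟨y, h.symm⟩
    -- Two partitions that differ only in the class of `z`. Since `z` is outside `Im θ`, their
    -- preimages under `θ` agree; the point `θ y` ensures that the second class of each meets `Im
    -- θ`.
    let π₁ : PiTheta θ := ⟨_, saturates_ker_eq (y := θ x) ⟨x, rfl⟩ ⟨y, rfl⟩ hxy.symm⟩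
    let π₂ : PiTheta θ := ⟨Setoid.ker fun t => t = θ x ∨ t = z, fun t => by
      by_cases h : t = θ x ∨ t = z
      · exact ⟨θ x, ⟨x, rfl⟩, by simp [h]⟩
      · exact ⟨θ y, ⟨y, rfl⟩, by simp [h, hxy.symm, hzy.symm]⟩⟩
    have hcomap : π₁.rel.comap θ = π₂.rel.comap θ := by
      ext s t
      change (θ s = θ x) = (θ t = θ x) ↔ (θ s = θ x ∨ θ s = z) = (θ t = θ x ∨ θ t = z)
      have : ∀ s, θ s ≠ z := fun s h => hz ⟨s, h⟩
      simp only [this, or_false]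
    have h : gammaCone π₁ = gammaCone π₂ := partitionCone_congr hcomap
    have h₁₂ := @hinj π₁ π₂ (by
      change NormalDual.mk _ _ = NormalDual.mk _ _
      congr 1
      exact congrArg HFunctor h)
    have h₂ : π₂.rel (θ x) z := by
      change (_ ∨ _) = (_ ∨ _)
      simp
    rw [← h₁₂] at h₂
    have h₃ : (θ x = θ x) = (z = θ x) := h₂
    exact hzx (h₃ ▸ rfl)

end PartitionCones

end CrossConnection

theorem mainTheorem2 {X : Type u} [Nonempty X] (θ : X → X) :
    (∃ Δ : CrossConnection.PTheta θ ⥤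
        CrossConnection.NormalDual (CrossConnection.PiTheta θ),
      (∀ A : CrossConnection.PTheta θ,
        CrossConnection.IsSubsetObj (Δ.obj A) (θ '' A.carrier)) ∧
      (∀ (A B : CrossConnection.PTheta θ) (f : A ⟶ B),
        CrossConnection.IsSubsetHom (Δ.map f) (CrossConnection.deltaMap f)) ∧
      CrossConnection.IsCrossConnection Δ ∧
      (¬ Function.Bijective θ → ¬ CrossConnection.IsCategoryIso Δ)) ∧
    (∃ Γ : CrossConnection.PiTheta θ ⥤
        CrossConnection.NormalDual (CrossConnection.PTheta θ),
      (∀ π : CrossConnection.PiTheta θ,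
        CrossConnection.IsPartitionObj (Γ.obj π) (π.rel.comap θ)) ∧
      (∀ (π₁ π₂ : CrossConnection.PiTheta θ) (η : π₁ ⟶ π₂) (C : CrossConnection.PTheta θ)
        (hC : CrossConnection.IsCrossSection C.carrier (π₁.rel.comap θ)),
        CrossConnection.IsPartitionHom (Γ.map η) (π₁.rel.comap θ)
          (CrossConnection.gammaMap η C hC)) ∧
      CrossConnection.IsCrossConnection Γ ∧
      (¬ Function.Bijective θ → (∃ x y : X, θ x ≠ θ y) →
        ¬ CrossConnection.IsCategoryIso Γ)) :=
  ⟨⟨(CrossConnection.deltaSystem θ).functor, CrossConnection.isSubsetObj_delta,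
      fun _ _ => CrossConnection.isSubsetHom_delta, CrossConnection.isCrossConnection_delta θ,
      CrossConnection.not_isCategoryIso_delta⟩,
    ⟨(CrossConnection.gammaSystem θ).functor, CrossConnection.isPartitionObj_gamma,
      fun _ _ => CrossConnection.isPartitionHom_gamma, CrossConnection.isCrossConnection_gamma θ,
      CrossConnection.not_isCategoryIso_gamma⟩⟩
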